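/- Let $k$ be a unital commutative ring and write $[n]=\{0,1,\dots,n\}$. For a small category $\mathbf C$, a functor $G\colon\mathbf C^{op}\to\mathbf{Mod}_k$ and a functor $F\colon\mathbf C\to\mathbf{Mod}_k$, let $G\otimes_{\mathbf C}F=\int^{c}G(c)\otimes_k F(c)$ and let $\mathrm{Tor}^{\mathbf C}_\star(G,F)$ denote the left derived functors of $-\otimes_{\mathbf C}-$; let $k^*$ denote the constant functor with value $k$. Let $A$ be an involutive $k$-algebra, i.e. an associative unital $k$-algebra with an additive map $a\mapsto\overline a$ with $\overline{ab}=\overline b\,\overline a$, $\overline{\overline a}=a$ and $\overline{\lambda}=\lambda$ for $\lambda\in k$. Let $M$ be an involutive $A$-bimodule, i.e. an $A$-bimodule on which the left and right actions of $k$ agree, with an additive map $m\mapsto\overline m$ with $\overline{\overline m}=m$ and $\overline{a_1ma_2}=\overline{a_2}\,\overline m\,\overline{a_1}$. *The reflexive category.* $\Delta R$ has objects $[n]$, $n\ge 0$; a morphism $[n]\to[m]$ is uniquely a composite $\varphi\circ g$ of an element $g$ of the group $\{1,r_{n+1}\}$ of order two and an order-preserving map $\varphi\colon[n]\to[m]$,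 with $r_{m+1}\circ\varphi=\varphi'\circ r_{n+1}$, $\varphi'(i)=m-\varphi(n-i)$. The Loday functor $\mathcal L(A,M)\colon\Delta R^{op}\to\mathbf{Mod}_k$ is $[n]\mapsto M\otimes A^{\otimes n}$ with the usual Hochschild faces $\partial_0(m\otimes a_1\otimes\cdots\otimes a_n)=ma_1\otimes a_2\otimes\cdots\otimes a_n$, $\partial_i(m\otimes a_1\otimes\cdots\otimes a_n)=m\otimes\cdots\otimes a_ia_{i+1}\otimes\cdots\otimes a_n$ for $0<i<n$, $\partial_n(m\otimes a_1\otimes\cdots\otimes a_n)=a_nm\otimes a_1\otimes\cdots\otimes a_{n-1}$, with degeneracies $s_j$, $0\le j\le n$, inserting $1_A$ after $a_j$ (after $m$ if $j=0$), and with $r_{n+1}(m\otimes a_1\otimes\cdots\otimes a_n)=\overline m\otimes\overline{a_n}\otimes\cdots\otimes\overline{a_1}$. Put $HR_\star(A,M)=\mathrm{Tor}^{\Delta R^{op}}_\star(k^*,\mathcal L(A,M))$. *Involutive non-commutative sets.* Let $C_2=\{1,t\}$. The category $\mathcal{IF}(as)$ has objects $[n]$, $n\geq 0$; a morphism $f\colon[n]\to[m]$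 is a map of sets together with, for each $i\in[m]$, a total order on $f^{-1}(i)$ and a label in $C_2$ for each element of $f^{-1}(i)$. Composition is composition of maps, with $(g\circ f)^{-1}(i)=\coprod_{j^\alpha\in g^{-1}(i)}\alpha * f^{-1}(j)$ (ordered disjoint union), where $t*(-)$ reverses the order and multiplies all labels by $t$. The subcategory $\mathcal I\Gamma(as)$ has the same objects and the morphisms with $f(0)=0$. The functor $\mathsf R(A,M)\colon\mathcal I\Gamma(as)\to\mathbf{Mod}_k$ is $[n]\mapsto M\otimes A^{\otimes n}$, $\mathsf R(A,M)(f)(a_0\otimes\cdots\otimes a_n)=b_0\otimes\cdots\otimes b_m$ ($a_0\in M$, $a_j\in A$ for $j>0$), where $b_i$ is the product, in the order of $f^{-1}(i)$, of the elements $a_j$ (if the label of $j$ is $1$) or $\overline{a_j}$ (if it is $t$), $j\in f^{-1}(i)$, an empty product being $1_A$. *The functor $B'$.* A bijection $[n]\to[n]$ with a label for each element of $[n]$ is an automorphism of $[n]$ in $\mathcal{IF}(as)$; these form the hyperoctahedral group $H_{n+1}$. Let $H^+_{n+1}\subset H_{n+1}$ consist of the elements which fix $0$ and for which $0$ has label $1$.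 Let $R,T\in H_{n+1}$ be $i\mapsto n-i$ with all labels $t$, respectively $i\mapsto i+1$ (and $n\mapsto0$) with all labels $1$. Let $\Delta D\subset\mathcal{IF}(as)$ be the subcategory of the composites $\varphi\circ d$ with $d$ in the subgroup generated by $R$ and $T$, and $\varphi$ an order-preserving map (with fibres in natural order and labels $1$). Every morphism $f\colon[n]\to[m]$ of $\mathcal{IF}(as)$ is uniquely $f=a\circ h$ with $h\in H^+_{n+1}$ and $a\in\Delta D$; call $h$ the $H^+$-component of $f$. Let $B\colon\mathcal{IF}(as)^{op}\to\mathbf{Mod}_k$ be the functor $B([n])=k[H^+_{n+1}]$ for which $f\colon[n']\to[n]$ sends the basis element $h$ to the $H^+$-component of $h\circ f$, and let $B'$ be its restriction to $\mathcal I\Gamma(as)$. Then there is an isomorphism of graded $k$-modules $$HR_\star(A,M)=\mathrm{Tor}^{\Delta R^{op}}_\star(k^*,\mathcal L(A,M))\;\cong\;\mathrm{Tor}^{\mathcal I\Gamma(as)}_\star(B',\mathsf R(A,M)).$$ -/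

import Mathlib

open CategoryTheory CategoryTheory.Limits MonoidalCategory Opposite

universe u

namespace ReflexiveHomology

section FunctorHomology

variable {k : Type u} [CommRing k] {C : Type} [SmallCategory C]

/-- The bifunctor `(c, d) ↦ G(c) ⊗ F(d)`. -/
noncomputable def externalTensor (G : Cᵒᵖ ⥤ ModuleCat.{u} k) (F : C ⥤ ModuleCat.{u} k) :
    Cᵒᵖ ⥤ C ⥤ ModuleCat.{u} k where
  obj c :=
    { obj := fun d => G.obj c ⊗ F.obj d
      map := fun f => G.obj c ◁ F.map f }
  map g := { app := fun d => G.map g ▷ F.obj d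
             naturality := fun _ _ f => (whisker_exchange (G.map g) (F.map f)) }

/-- The functor `F ↦ G ⊗_C F = ∫^c G(c) ⊗ F(c)`. -/
noncomputable def tensorOver (G : Cᵒᵖ ⥤ ModuleCat.{u} k) :
    (C ⥤ ModuleCat.{u} k) ⥤ ModuleCat.{u} k where
  obj F := coend (externalTensor G F)
  map α := coend.map
    { app := fun c => { app := fun d => G.obj c ◁ α.app d
                        naturality := fun _ _ f => by
                          simp only [externalTensor, ← MonoidalCategory.whiskerLeft_comp,
                            α.naturality] }
      naturality := fun _ _ g => by
        ext d : 2
        exact (whisker_exchange (G.map g) (α.app d)).symm }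
  map_id F := by
    apply coend.hom_ext
    intro c
    rw [coend.ι_map]
    simp
    rfl
  map_comp α β := by
    apply coend.hom_ext
    intro c
    rw [coend.ι_map, coend.ι_map_assoc, coend.ι_map]
    simp only [NatTrans.comp_app, MonoidalCategory.whiskerLeft_comp]
    exact Category.assoc _ _ _

instance (G : Cᵒᵖ ⥤ ModuleCat.{u} k) : (tensorOver G).Additive where
  map_add {F F'} {α β} := by
    apply coend.hom_ext
    intro c
    refine Eq.trans ?_ (Preadditive.comp_add _ _ _ _ _ _).symm
    refine (coend.ι_map _ _).trans ?_
    refine Eq.trans ?_ (congrArg₂ (· + ·) (coend.ι_map _ _) (coend.ι_map _ _)).symm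
    refine Eq.trans ?_ (Preadditive.add_comp _ _ _ _ _ _)
    congr 1
    exact MonoidalPreadditive.whiskerLeft_add _ _

/-- The free functor on all elements of `F`; it is projective and surjects onto `F`. -/
noncomputable def freeCover (F : C ⥤ ModuleCat.{u} k) : C ⥤ ModuleCat.{u} k where
  obj d := ModuleCat.of k ((Σ c : C, F.obj c × (c ⟶ d)) →₀ k)
  map g := ModuleCat.ofHom (Finsupp.lmapDomain k k (fun x => ⟨x.1, x.2.1, x.2.2 ≫ g⟩))
  map_id d := by
    ext x : 3
    simp
  map_comp f g := by
    ext x : 3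
    simp

/-- The generators of `freeCover F`. -/
noncomputable def freeCoverGen (F : C ⥤ ModuleCat.{u} k) {c d : C} (x : F.obj c) (h : c ⟶ d) :
    (freeCover F).obj d :=
  (Finsupp.single ⟨c, x, h⟩ 1 : (Σ c : C, F.obj c × (c ⟶ d)) →₀ k)

lemma freeCover_map_gen (F : C ⥤ ModuleCat.{u} k) {c d d' : C} (x : F.obj c) (h : c ⟶ d)
    (g : d ⟶ d') :
    ((freeCover F).map g).hom (freeCoverGen F x h) = freeCoverGen F x (h ≫ g) :=
  Finsupp.mapDomain_single

lemma freeCover_hom_ext (F : C ⥤ ModuleCat.{u} k) {d : C} {X : ModuleCat.{u} k}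
    {f g : (freeCover F).obj d ⟶ X}
    (h : ∀ (c : C) (x : F.obj c) (a : c ⟶ d),
      f.hom (freeCoverGen F x a) = g.hom (freeCoverGen F x a)) : f = g := by
  apply ModuleCat.hom_ext
  apply Finsupp.lhom_ext'
  rintro ⟨c, x, a⟩
  apply LinearMap.ext_ring
  exact h c x a

/-- The values of `freeCoverDesc`. -/
noncomputable def freeCoverDescApp (F X : C ⥤ ModuleCat.{u} k) (s : ∀ c, F.obj c → X.obj c)
    (d : C) : (freeCover F).obj d ⟶ X.obj d :=
  ModuleCat.ofHom (Finsupp.lsum k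
    (fun x : (Σ c : C, F.obj c × (c ⟶ d)) =>
      LinearMap.toSpanSingleton k _ ((X.map x.2.2).hom (s x.1 x.2.1))))

lemma freeCoverDescApp_gen (F X : C ⥤ ModuleCat.{u} k) (s : ∀ c, F.obj c → X.obj c)
    {c d : C} (x : F.obj c) (h : c ⟶ d) :
    (freeCoverDescApp F X s d).hom (freeCoverGen F x h) = (X.map h).hom (s c x) := by
  refine (Finsupp.sum_single_index (by simp)).trans ?_
  simp

/-- Maps out of `freeCover F` are given by choosing the images of the generators. -/
noncomputable def freeCoverDesc (F X : C ⥤ ModuleCat.{u} k) (s : ∀ c, F.obj c → X.obj c) :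
    freeCover F ⟶ X where
  app d := freeCoverDescApp F X s d
  naturality d d' g := by
    apply freeCover_hom_ext
    intro c x a
    simp only [ModuleCat.hom_comp, LinearMap.comp_apply, freeCover_map_gen, freeCoverDescApp_gen,
      Functor.map_comp]

instance (F : C ⥤ ModuleCat.{u} k) : Projective (freeCover F) where
  factors {X Y} f e he := by
    have hs : ∀ c, Function.Surjective (e.app c).hom := fun c =>
      (ModuleCat.epi_iff_surjective _).1 ((NatTrans.epi_iff_epi_app e).1 he c)
    choose s hs using fun (c : C) (x : F.obj c) =>
      hs c ((f.app c).hom (freeCoverGen F x (𝟙 c)))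
    refine ⟨freeCoverDesc F X s, ?_⟩
    apply NatTrans.ext
    funext d
    apply freeCover_hom_ext
    intro c x g
    have h1 := congrArg (fun φ => φ.hom (s c x)) (e.naturality g)
    have h2 := congrArg (fun φ => φ.hom (freeCoverGen F x (𝟙 c))) (f.naturality g)
    simp only [ModuleCat.hom_comp, LinearMap.comp_apply, freeCover_map_gen,
      Category.id_comp] at h1 h2
    simp only [NatTrans.comp_app, ModuleCat.hom_comp, LinearMap.comp_apply, freeCoverDesc,
      freeCoverDescApp_gen]
    rw [h1, hs, h2]

instance enoughProjectives : EnoughProjectives (C ⥤ ModuleCat.{u} k) where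
  presentation F := by
    refine ⟨{ p := freeCover F, f := freeCoverDesc F F (fun _ x => x), epi := ?_ }⟩
    rw [NatTrans.epi_iff_epi_app]
    intro c
    rw [ModuleCat.epi_iff_surjective]
    intro x
    refine ⟨freeCoverGen F x (𝟙 c), ?_⟩
    refine (freeCoverDescApp_gen F F _ x (𝟙 c)).trans ?_
    simp

/-- `Tor_n^C(G, F)`: the `n`-th left derived functor of `G ⊗_C -`, evaluated at `F`. -/
noncomputable def functorTor (n : ℕ) (G : Cᵒᵖ ⥤ ModuleCat.{u} k) (F : C ⥤ ModuleCat.{u} k) :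
    ModuleCat.{u} k :=
  ((tensorOver G).leftDerived n).obj F

end FunctorHomology

section InvolutiveNoncommutativeSets

/-! A finite totally ordered `C₂`-set on elements of `X` is a duplicate-free list of elements
of `X` with labels in `C₂ = {1, t}`; the label `1` is `false`, `t` is `true`, and the product
of labels is `xor`. -/

/-- The action of `C₂` on labelled lists: `t` reverses the order and multiplies all labels
by `t`. -/
def act {X : Type} (α : Bool) (l : List (X × Bool)) : List (X × Bool) :=
  if α then (l.map fun p => (p.1, !p.2)).reverse else l

/-- The ordered disjoint union `∐_{j^α ∈ l} α * F(j)`. -/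
def pull {X Y : Type} (F : Y → List (X × Bool)) (l : List (Y × Bool)) : List (X × Bool) :=
  l.flatMap fun p => act p.2 (F p.1)

section
variable {X Y Z : Type}

@[simp] lemma act_false (l : List (X × Bool)) : act false l = l := rfl

lemma act_true (l : List (X × Bool)) : act true l = (l.map fun p => (p.1, !p.2)).reverse := rfl

@[simp] lemma act_nil (α : Bool) : act α ([] : List (X × Bool)) = [] := by
  cases α <;> rfl

@[simp] lemma act_singleton (α : Bool) (x : X × Bool) : act α [x] = [(x.1, xor α x.2)] := by
  cases α <;> simp [act]

@[simp] lemma act_act (α β : Bool) (l : List (X × Bool)) : act α (act β l) = act (xor α β) l := by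
  cases α <;> cases β <;> simp [act, Function.comp_def]

lemma act_true_append (l l' : List (X × Bool)) :
    act true (l ++ l') = act true l' ++ act true l := by
  simp [act]

lemma map_fst_act (α : Bool) (l : List (X × Bool)) :
    ((act α l).map Prod.fst).Perm (l.map Prod.fst) := by
  cases α
  · rfl
  · simp only [act, if_true, List.map_reverse, List.map_map]
    exact List.reverse_perm _

@[simp] lemma mem_map_fst_act (α : Bool) (l : List (X × Bool)) (x : X) :
    x ∈ (act α l).map Prod.fst ↔ x ∈ l.map Prod.fst :=
  (map_fst_act α l).mem_iff

@[simp] lemma pull_nil (F : Y → List (X × Bool)) : pull F [] = [] := rfl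

@[simp] lemma pull_cons (F : Y → List (X × Bool)) (p : Y × Bool) (l : List (Y × Bool)) :
    pull F (p :: l) = act p.2 (F p.1) ++ pull F l := rfl

@[simp] lemma pull_append (F : Y → List (X × Bool)) (l l' : List (Y × Bool)) :
    pull F (l ++ l') = pull F l ++ pull F l' := by
  simp [pull]

lemma pull_act (F : Y → List (X × Bool)) (α : Bool) (l : List (Y × Bool)) :
    pull F (act α l) = act α (pull F l) := by
  cases α
  · rfl
  · induction l with
    | nil => rfl
    | cons p l ih =>
      have : p :: l = [p] ++ l := rfl
      rw [this, act_true_append, pull_append, pull_append, act_true_append, ih]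
      simp

lemma pull_pull (F : Y → List (X × Bool)) (G : Z → List (Y × Bool)) (l : List (Z × Bool)) :
    pull F (pull G l) = pull (fun i => pull F (G i)) l := by
  induction l with
  | nil => rfl
  | cons p l ih => simp [ih, pull_act]

lemma pull_single (l : List (X × Bool)) : pull (fun i => [(i, false)]) l = l := by
  induction l with
  | nil => rfl
  | cons p l ih => simp [ih]

lemma mem_map_fst_pull (F : Y → List (X × Bool)) (l : List (Y × Bool)) (x : X) :
    x ∈ (pull F l).map Prod.fst ↔ ∃ y ∈ l.map Prod.fst, x ∈ (F y).map Prod.fst := by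
  induction l with
  | nil => simp
  | cons p l ih =>
    rw [pull_cons, List.map_append, List.mem_append, ih, mem_map_fst_act]
    simp only [List.map_cons, List.mem_cons, exists_eq_or_imp]

end

/-- A morphism `[n] → [m]` of involutive non-commutative sets: a map of finite sets together
with the structure of a totally ordered `C₂`-set on every fibre. -/
structure IFHom (n m : ℕ) where
  toFun : Fin (n + 1) → Fin (m + 1)
  /-- the fibre over `i`, listed in increasing order, with labels -/
  fiber : Fin (m + 1) → List (Fin (n + 1) × Bool)
  nodup : ∀ i, ((fiber i).map Prod.fst).Nodup
  mem_fiber : ∀ i j, j ∈ (fiber i).map Prod.fst ↔ toFun j = i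

namespace IFHom

lemma ext_fiber {n m : ℕ} {f g : IFHom n m} (h : ∀ i, f.fiber i = g.fiber i) : f = g := by
  have h1 : f.toFun = g.toFun := by
    funext j
    have := (f.mem_fiber _ j).2 rfl
    rw [h, g.mem_fiber] at this
    exact this.symm
  have h2 : f.fiber = g.fiber := funext h
  cases f; cases g
  simp only at h1 h2
  subst h1 h2
  rfl

/-- The identity of `[n]`. -/
def id (n : ℕ) : IFHom n n where
  toFun := fun j => j
  fiber := fun i => [(i, false)]
  nodup := by simp
  mem_fiber := by simp

/-- The composite `g ∘ f`, with fibres `∐_{j^α ∈ g⁻¹(i)} α * f⁻¹(j)`. -/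
def comp {n m p : ℕ} (f : IFHom n m) (g : IFHom m p) : IFHom n p where
  toFun := fun j => g.toFun (f.toFun j)
  fiber := fun i => pull f.fiber (g.fiber i)
  nodup := by
    intro i
    have h := g.nodup i
    generalize g.fiber i = l at h
    induction l with
    | nil => simp
    | cons q l ih =>
      rw [List.map_cons, List.nodup_cons] at h
      rw [pull_cons, List.map_append, List.nodup_append']
      refine ⟨(map_fst_act _ _).nodup_iff.2 (f.nodup _), ih h.2, ?_⟩
      intro x hx hx'
      rw [mem_map_fst_act, f.mem_fiber] at hx
      rw [mem_map_fst_pull] at hx'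
      obtain ⟨y, hy, hxy⟩ := hx'
      rw [f.mem_fiber] at hxy
      rw [← hx, hxy] at h
      exact h.1 hy
  mem_fiber := by
    intro i j
    rw [mem_map_fst_pull]
    simp only [f.mem_fiber, g.mem_fiber]
    exact ⟨fun ⟨y, h1, h2⟩ => h2 ▸ h1, fun h => ⟨_, h, rfl⟩⟩

end IFHom

/-- The category of involutive non-commutative sets; `⟨n⟩` is the set `[n] = {0, …, n}`. -/
structure IFas where
  n : ℕ

instance : SmallCategory IFas where
  Hom x y := IFHom x.n y.n
  id x := IFHom.id x.n
  comp f g := IFHom.comp f g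
  id_comp f := IFHom.ext_fiber fun i => pull_single _
  comp_id f := IFHom.ext_fiber fun i => by simp [IFHom.comp, IFHom.id]
  assoc f g h := IFHom.ext_fiber fun i => (pull_pull _ _ _).symm

lemma comp_fiber {x y z : IFas} (f : x ⟶ y) (g : y ⟶ z) (i : Fin (z.n + 1)) :
    IFHom.fiber (f ≫ g) i = pull (IFHom.fiber f) (IFHom.fiber g i) := rfl

lemma comp_toFun {x y z : IFas} (f : x ⟶ y) (g : y ⟶ z) (i : Fin (x.n + 1)) :
    IFHom.toFun (f ≫ g) i = IFHom.toFun g (IFHom.toFun f i) := rfl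

lemma id_fiber (x : IFas) (i : Fin (x.n + 1)) : IFHom.fiber (𝟙 x) i = [(i, false)] := rfl

/-- The morphisms `f` with `f(0) = 0`. -/
def IsBased : MorphismProperty IFas := fun _ _ f => IFHom.toFun f 0 = 0

instance : IsBased.IsMultiplicative where
  id_mem _ := rfl
  comp_mem f g hf hg := by
    change IFHom.toFun g (IFHom.toFun f 0) = 0
    rw [show IFHom.toFun f 0 = 0 from hf]
    exact hg

/-- The category of based involutive non-commutative sets. -/
abbrev IGammaAs := WideSubcategory IsBased

/-- An element `(z_0, …, z_n; σ)` of the hyperoctahedral group `H_{n+1} = C₂^{n+1} ⋊ Σ_{n+1}`. -/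
@[ext] structure Hyp (n : ℕ) where
  sign : Fin (n + 1) → Bool
  perm : Equiv.Perm (Fin (n + 1))

/-- The automorphism of `[n]` in the category of involutive non-commutative sets given by
`(z_0, …, z_n; σ)`: the map `σ`, where `j` has label `z_j`. -/
def Hyp.toHom {n : ℕ} (h : Hyp n) : (⟨n⟩ : IFas) ⟶ ⟨n⟩ :=
  { toFun := h.perm
    fiber := fun i => [(h.perm.symm i, h.sign (h.perm.symm i))]
    nodup := by simp
    mem_fiber := by
      intro i j
      simp [Equiv.eq_symm_apply] : IFHom n n }

/-- The subgroup `H⁺_{n+1}`: elements with `z_0 = 1` and `σ(0) = 0`. -/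
def HPlus (n : ℕ) := { h : Hyp n // h.sign 0 = false ∧ h.perm 0 = 0 }

/-- The morphism of involutive non-commutative sets given by an element of `H⁺_{n+1}`. -/
def HPlus.toHom {n : ℕ} (h : HPlus n) : (⟨n⟩ : IFas) ⟶ ⟨n⟩ := h.1.toHom

/-- The element `R = (t, …, t; r)` with `r(i) = n - i`. -/
def dihR (n : ℕ) : Hyp n := ⟨fun _ => true, Fin.revPerm⟩

/-- The element `T = (1, …, 1; t)` with `t(i) = i + 1` for `i < n` and `t(n) = 0`. -/
def dihT (n : ℕ) : Hyp n := ⟨fun _ => false, finRotate (n + 1)⟩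

/-- The dihedral subgroup generated by `R` and `T` (elements of finite order, so the generated
submonoid is the generated subgroup). -/
def dihedralGroup (n : ℕ) : Submonoid (End (⟨n⟩ : IFas)) :=
  Submonoid.closure {(dihR n).toHom, (dihT n).toHom}

/-- An order-preserving map, with all fibres in their natural order and all labels `1`. -/
def ofMono {n m : ℕ} (φ : Fin (n + 1) →o Fin (m + 1)) : (⟨n⟩ : IFas) ⟶ ⟨m⟩ :=
  { toFun := φ
    fiber := fun i => ((List.finRange (n + 1)).filter fun j => φ j = i).map fun j => (j, false)
    nodup := fun i => by
      rw [List.map_map]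
      exact (List.Nodup.filter _ (List.nodup_finRange _)).map fun _ _ h => h
    mem_fiber := fun i j => by simp : IFHom n m }

/-- The subcategory `ΔD = Δ ∘ D`: the composites `φ ∘ d` of an element `d` of the dihedral
group and an order-preserving map `φ`. -/
def IsDihedral {x y : IFas} (f : x ⟶ y) : Prop :=
  ∃ d ∈ dihedralGroup x.n, ∃ φ : Fin (x.n + 1) →o Fin (y.n + 1),
    f = CategoryStruct.comp (Y := x) d (ofMono φ)

/-! ### The decomposition of morphisms needed to define the functor `B` -/

/-- The concatenation of all fibres. -/
def tot {x y : IFas} (f : x ⟶ y) : List (Fin (x.n + 1) × Bool) :=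
  (List.finRange (y.n + 1)).flatMap (IFHom.fiber f)

/-- The list `0, …, n` with trivial labels. -/
def std (n : ℕ) : List (Fin (n + 1) × Bool) := (List.finRange (n + 1)).map fun j => (j, false)

lemma pull_std {n : ℕ} {X : Type} (F : Fin (n + 1) → List (X × Bool)) :
    pull F (std n) = (List.finRange (n + 1)).flatMap F := by
  simp [pull, std, List.flatMap_map]

lemma tot_eq {x y : IFas} (f : x ⟶ y) : tot f = pull (IFHom.fiber f) (std y.n) :=
  (pull_std _).symm

lemma tot_comp {x y z : IFas} (f : x ⟶ y) (g : y ⟶ z) :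
    tot (f ≫ g) = pull (IFHom.fiber f) (tot g) := by
  rw [tot_eq, tot_eq, pull_pull]
  rfl

lemma tot_id (x : IFas) : tot (𝟙 x) = std x.n := by
  rw [tot_eq]
  exact pull_single _

/-- Equality up to rotation and up to the action of `t`. -/
def Dih {X : Type} (l l' : List (X × Bool)) : Prop := ∃ α, l.IsRotated (act α l')

lemma isRotated_act {X : Type} {l l' : List (X × Bool)} (h : l.IsRotated l') (α : Bool) :
    (act α l).IsRotated (act α l') := by
  cases α
  · exact h
  · exact (h.map _).reverse

lemma isRotated_pull {X Y : Type} (F : Y → List (X × Bool)) {l l' : List (Y × Bool)}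
    (h : l.IsRotated l') : (pull F l).IsRotated (pull F l') := by
  obtain ⟨n, rfl⟩ := h
  rw [List.rotate_eq_drop_append_take_mod]
  conv_lhs => rw [← List.take_append_drop (n % l.length) l]
  rw [pull_append, pull_append]
  exact List.isRotated_append

lemma Dih.refl {X : Type} (l : List (X × Bool)) : Dih l l := ⟨false, List.IsRotated.refl _⟩

lemma Dih.symm {X : Type} {l l' : List (X × Bool)} (h : Dih l l') : Dih l' l := by
  obtain ⟨α, h⟩ := h
  refine ⟨α, ?_⟩
  have := isRotated_act h α
  rw [act_act, Bool.xor_self, act_false] at this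
  exact this.symm

lemma Dih.trans {X : Type} {l l' l'' : List (X × Bool)} (h : Dih l l') (h' : Dih l' l'') :
    Dih l l'' := by
  obtain ⟨α, h⟩ := h
  obtain ⟨β, h'⟩ := h'
  refine ⟨xor α β, h.trans ?_⟩
  rw [← act_act]
  exact isRotated_act h' α

lemma Dih.pull {X Y : Type} (F : Y → List (X × Bool)) {l l' : List (Y × Bool)}
    (h : Dih l l') : Dih (pull F l) (pull F l') := by
  obtain ⟨α, h⟩ := h
  exact ⟨α, by rw [← pull_act]; exact isRotated_pull F h⟩

lemma map_fst_tot_perm {x y : IFas} (f : x ⟶ y) :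
    ((tot f).map Prod.fst).Perm (List.finRange (x.n + 1)) := by
  rw [List.perm_ext_iff_of_nodup _ (List.nodup_finRange _)]
  · intro j
    simp only [List.mem_finRange, iff_true, tot, List.map_flatMap, List.mem_flatMap, true_and]
    exact ⟨_, (IFHom.mem_fiber f _ j).2 rfl⟩
  · rw [tot, List.map_flatMap, List.nodup_flatMap]
    refine ⟨fun i _ => IFHom.nodup f i, ?_⟩
    refine (List.nodup_finRange _).imp ?_
    intro i i' hne j hj hj'
    rw [IFHom.mem_fiber] at hj hj'
    exact hne (hj.symm.trans hj')

lemma length_tot {x y : IFas} (f : x ⟶ y) : (tot f).length = x.n + 1 := by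
  simpa using (map_fst_tot_perm f).length_eq

lemma tot_filter {x y : IFas} (f : x ⟶ y) (i : Fin (y.n + 1)) :
    (tot f).filter (fun p => IFHom.toFun f p.1 = i) = IFHom.fiber f i := by
  have h : ∀ i', (IFHom.fiber f i').filter (fun p => IFHom.toFun f p.1 = i) =
      if i' = i then IFHom.fiber f i' else [] := by
    intro i'
    have h0 : ∀ p ∈ IFHom.fiber f i', IFHom.toFun f p.1 = i' := fun p hp =>
      (IFHom.mem_fiber f i' p.1).1 (List.mem_map_of_mem hp)
    split_ifs with hi
    · rw [List.filter_eq_self]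
      intro p hp
      simp [h0 p hp, hi]
    · rw [List.filter_eq_nil_iff]
      intro p hp
      simp [h0 p hp, hi]
  rw [tot, List.filter_flatMap]
  simp only [h]
  have key : ∀ l : List (Fin (y.n + 1)), l.Nodup → i ∈ l →
      (l.flatMap fun i' => if i' = i then IFHom.fiber f i' else []) = IFHom.fiber f i := by
    intro l
    induction l with
    | nil => simp
    | cons a l ih =>
      intro hn hm
      rw [List.nodup_cons] at hn
      rw [List.flatMap_cons]
      by_cases ha : a = i
      · subst ha
        have : (l.flatMap fun i' => if i' = a then IFHom.fiber f i' else []) = [] := by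
          rw [List.flatMap_eq_nil_iff]
          intro b hb
          rw [if_neg]
          rintro rfl
          exact hn.1 hb
        simp [this]
      · rw [if_neg ha, List.nil_append]
        exact ih hn.2 (by simpa [Ne.symm ha] using hm)
  exact key _ (List.nodup_finRange _) (List.mem_finRange _)

lemma tot_pairwise {x y : IFas} (f : x ⟶ y) :
    (tot f).Pairwise fun p q => IFHom.toFun f p.1 ≤ IFHom.toFun f q.1 := by
  have h0 : ∀ i, ∀ p ∈ IFHom.fiber f i, IFHom.toFun f p.1 = i := fun i p hp =>
    (IFHom.mem_fiber f i p.1).1 (List.mem_map_of_mem hp)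
  rw [tot, List.pairwise_flatMap]
  refine ⟨fun i _ => ?_, ?_⟩
  · apply List.pairwise_of_forall_mem_list
    intro p hp q hq
    rw [h0 i p hp, h0 i q hq]
  · refine (List.pairwise_lt_finRange _).imp ?_
    intro i j hij p hp q hq
    rw [h0 i p hp, h0 j q hq]
    exact hij.le

lemma tot_ofMono {n m : ℕ} (φ : Fin (n + 1) →o Fin (m + 1)) : tot (ofMono φ) = std n := by
  have h2 : ∀ p ∈ tot (ofMono φ), p.2 = false := by
    intro p hp
    simp only [tot, List.mem_flatMap, ofMono, List.mem_map] at hp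
    obtain ⟨_, _, _, _, rfl⟩ := hp
    rfl
  have h1 : (tot (ofMono φ)).map Prod.fst = List.finRange (n + 1) := by
    refine (map_fst_tot_perm (ofMono φ)).eq_of_pairwise (le := (· ≤ ·))
      (fun a b _ _ h h' => le_antisymm h h') ?_ (List.pairwise_le_finRange _)
    rw [tot, List.map_flatMap, List.pairwise_flatMap]
    refine ⟨fun i _ => ?_, ?_⟩
    · simp only [ofMono, List.map_map]
      exact ((List.pairwise_le_finRange _).filter _).map _ fun _ _ h => h
    · refine (List.pairwise_lt_finRange _).imp ?_
      intro i j hij a ha b hb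
      rw [IFHom.mem_fiber] at ha hb
      by_contra hab
      have := φ.monotone (not_le.1 hab).le
      have ha' : φ a = i := ha
      have hb' : φ b = j := hb
      rw [ha', hb'] at this
      exact absurd hij (not_lt.2 this)
  rw [std, ← h1, List.map_map]
  symm
  conv_rhs => rw [← List.map_id (tot (ofMono φ))]
  apply List.map_congr_left
  intro p hp
  exact Prod.ext rfl (h2 p hp).symm

/-! The labelled list of a hyperoctahedral element, and the element with a given list. -/

lemma tot_hyp {n : ℕ} (h : Hyp n) : tot h.toHom =
    (List.finRange (n + 1)).map fun i => (h.perm.symm i, h.sign (h.perm.symm i)) := by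
  simp only [tot, Hyp.toHom]
  exact List.flatMap_pure_eq_map _ _

/-- The product of hyperoctahedral elements (first `h`, then `g`). -/
def Hyp.comp {n : ℕ} (h g : Hyp n) : Hyp n :=
  ⟨fun j => xor (g.sign (h.perm j)) (h.sign j), h.perm.trans g.perm⟩

lemma Hyp.toHom_comp {n : ℕ} (h g : Hyp n) : (h.comp g).toHom = h.toHom ≫ g.toHom := by
  apply IFHom.ext_fiber
  intro i
  rw [comp_fiber]
  simp [Hyp.toHom, Hyp.comp, pull]

/-- Inverse of a hyperoctahedral element. -/
def Hyp.inv {n : ℕ} (h : Hyp n) : Hyp n := ⟨fun i => h.sign (h.perm.symm i), h.perm.symm⟩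

lemma Hyp.toHom_inv {n : ℕ} (h : Hyp n) : h.toHom ≫ h.inv.toHom = 𝟙 _ := by
  apply IFHom.ext_fiber
  intro i
  rw [comp_fiber, id_fiber]
  simp [Hyp.toHom, Hyp.inv, pull]

lemma Hyp.inv_toHom {n : ℕ} (h : Hyp n) : h.inv.toHom ≫ h.toHom = 𝟙 _ := by
  apply IFHom.ext_fiber
  intro i
  rw [comp_fiber, id_fiber]
  simp [Hyp.toHom, Hyp.inv, pull]

lemma exists_hyp {n : ℕ} (l : List (Fin (n + 1) × Bool))
    (hl : (l.map Prod.fst).Perm (List.finRange (n + 1))) : ∃ h : Hyp n, tot h.toHom = l := by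
  have hlen : l.length = n + 1 := by simpa using hl.length_eq
  have hnd : (l.map Prod.fst).Nodup := hl.nodup_iff.2 (List.nodup_finRange _)
  let s : Fin (n + 1) → Fin (n + 1) := fun i => (l[i.1]'(hlen.symm ▸ i.2)).1
  have hs : Function.Injective s := by
    intro i j hij
    have := (hnd.getElem_inj_iff (hi := by simpa [hlen] using i.2)
      (hj := by simpa [hlen] using j.2)).1 (by simpa [s] using hij)
    exact Fin.ext this
  let e : Equiv.Perm (Fin (n + 1)) := Equiv.ofBijective s (Finite.injective_iff_bijective.1 hs)
  refine ⟨⟨fun j => (l[(e.symm j).1]'(hlen.symm ▸ (e.symm j).2)).2, e.symm⟩, ?_⟩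
  rw [tot_hyp]
  apply List.ext_getElem
  · simp [hlen]
  · intro i h1 h2
    simp [e, s]

lemma tot_hyp_injective {n : ℕ} {h h' : Hyp n} (e : tot h.toHom = tot h'.toHom) : h = h' := by
  rw [tot_hyp, tot_hyp, List.map_inj_left] at e
  have h1 : h.perm.symm = h'.perm.symm := Equiv.ext fun i =>
    congrArg Prod.fst (e i (List.mem_finRange i))
  have h2 : h.perm = h'.perm := Equiv.symm_bijective.1 h1
  apply Hyp.ext _ h2
  funext j
  have := congrArg Prod.snd (e (h.perm j) (List.mem_finRange _))
  simpa [← h2] using this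

/-! Dihedral morphisms are those whose list is the standard one up to rotation and `t`. -/

lemma tot_dihR (n : ℕ) : tot (dihR n).toHom = act true (std n) := by
  rw [tot_hyp, act_true, std, List.map_map, ← List.map_reverse, List.finRange_reverse,
    List.map_map]
  rfl

lemma tot_dihT (n : ℕ) : tot (dihT n).toHom = (std n).rotate n := by
  rw [tot_hyp]
  apply List.ext_getElem
  · simp [std]
  · intro i h1 h2
    simp only [std, List.getElem_map, List.getElem_finRange, List.getElem_rotate, dihT]
    refine Prod.ext ?_ rfl
    simp only
    rw [Equiv.symm_apply_eq, finRotate_apply]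
    ext
    simp only [List.length_map, List.length_finRange] at h1
    simp only [List.length_map, List.length_finRange, Fin.val_add, Fin.val_one', Nat.add_mod_mod,
      Fin.val_cast, Nat.mod_add_mod]
    rw [show i + n + 1 = i + (n + 1) by ring]
    simp [Nat.mod_eq_of_lt h1]

lemma dih_of_mem {n : ℕ} {d : End (⟨n⟩ : IFas)} (hd : d ∈ dihedralGroup n) :
    Dih (tot (x := ⟨n⟩) (y := ⟨n⟩) d) (std n) := by
  induction hd using Submonoid.closure_induction with
  | mem d hd =>
    rcases hd with rfl | rfl
    · rw [tot_dihR]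
      exact ⟨true, List.IsRotated.refl _⟩
    · rw [tot_dihT]
      exact ⟨false, List.IsRotated.symm ⟨n, rfl⟩⟩
  | one => exact tot_id _ ▸ Dih.refl _
  | mul a b _ _ ha hb =>
    have h := tot_comp (x := ⟨n⟩) (y := ⟨n⟩) (z := ⟨n⟩) b a
    change Dih (tot (x := ⟨n⟩) (y := ⟨n⟩) (CategoryStruct.comp (X := (⟨n⟩ : IFas))
      (Y := ⟨n⟩) (Z := ⟨n⟩) b a)) _
    rw [h]
    refine (ha.pull _).trans ?_
    rw [← tot_eq (x := ⟨n⟩) (y := ⟨n⟩)]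
    exact hb

lemma dih_of_isDihedral {x y : IFas} {f : x ⟶ y} (hf : IsDihedral f) : Dih (tot f) (std x.n) := by
  obtain ⟨d, hd, φ, rfl⟩ := hf
  rw [tot_comp, tot_ofMono]
  rw [← tot_eq (x := ⟨x.n⟩) (y := ⟨x.n⟩)]
  exact dih_of_mem hd

lemma pull_rotate {n : ℕ} (h : Hyp n) (l : List (Fin (n + 1) × Bool)) (k : ℕ) :
    pull (IFHom.fiber h.toHom) (l.rotate k) = (pull (IFHom.fiber h.toHom) l).rotate k := by
  have : ∀ l, pull (IFHom.fiber h.toHom) l =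
      l.map fun p => (h.perm.symm p.1, xor p.2 (h.sign (h.perm.symm p.1))) := by
    intro l
    induction l with
    | nil => rfl
    | cons p l ih =>
      rw [pull_cons, ih]
      simp [Hyp.toHom]
  rw [this, this, List.map_rotate]

lemma exists_mem_dihedralGroup_rotate {n : ℕ} (d : Hyp n) (k : ℕ)
    (hd : (d.toHom : End (⟨n⟩ : IFas)) ∈ dihedralGroup n) :
    ∃ d' : Hyp n, (d'.toHom : End (⟨n⟩ : IFas)) ∈ dihedralGroup n ∧
      tot d'.toHom = (tot d.toHom).rotate k := by
  have step : ∀ j, ∃ d' : Hyp n, (d'.toHom : End (⟨n⟩ : IFas)) ∈ dihedralGroup n ∧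
      tot d'.toHom = (tot d.toHom).rotate (n * j) := by
    intro j
    induction j with
    | zero => exact ⟨d, hd, by simp⟩
    | succ j ih =>
      obtain ⟨d', h1, h2⟩ := ih
      have ht : tot (d'.toHom ≫ (dihT n).toHom) = (tot d.toHom).rotate (n * (j + 1)) := by
        rw [tot_comp, tot_dihT, pull_rotate, ← tot_eq, h2, List.rotate_rotate, mul_add, mul_one]
      refine ⟨d'.comp (dihT n), ?_, ?_⟩
      · rw [Hyp.toHom_comp]
        exact mul_mem (Submonoid.subset_closure (by simp)) h1
      · rw [Hyp.toHom_comp]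
        exact ht
  obtain ⟨d', h1, h2⟩ := step (n * k)
  refine ⟨d', h1, h2.trans ?_⟩
  rw [← List.rotate_mod, length_tot, ← List.rotate_mod (tot d.toHom) k, length_tot]
  congr 1
  rcases n with _ | n
  · simp [Nat.mod_one]
  · have : (n + 1) * ((n + 1) * k) = k + (n + 1 + 1) * (n * k) := by ring
    simp [this]

lemma isDihedral_of_tot {x y : IFas} (f : x ⟶ y) (d : Hyp x.n)
    (hd : (d.toHom : End (⟨x.n⟩ : IFas)) ∈ dihedralGroup x.n) (h : tot d.toHom = tot f) :
    IsDihedral f := by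
  have hm : Monotone fun i => IFHom.toFun f (d.perm.symm i) := by
    intro i j hij
    rcases hij.eq_or_lt with rfl | hij
    · exact le_rfl
    have hp := tot_pairwise f
    rw [← h, tot_hyp, List.pairwise_map] at hp
    have h1 := List.pairwise_iff_getElem.1 hp i.1 j.1 (by simpa using i.is_le)
      (by simpa using j.is_le) hij
    simp only [List.getElem_finRange] at h1
    exact h1
  refine ⟨d.toHom, hd, ⟨_, hm⟩, ?_⟩
  apply IFHom.ext_fiber
  intro i
  rw [← tot_filter f i, ← h, tot_hyp, List.filter_map]
  change _ = pull (IFHom.fiber d.toHom) (List.map _ _)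
  simp only [pull, List.flatMap_map, Hyp.toHom, act_false]
  exact (List.flatMap_pure_eq_map _ _).symm

lemma isDihedral_of_dih {x y : IFas} {f : x ⟶ y} (hf : Dih (tot f) (std x.n)) :
    IsDihedral f := by
  obtain ⟨α, h⟩ := hf
  obtain ⟨k, hk⟩ := h.symm
  have : ∃ d : Hyp x.n, (d.toHom : End (⟨x.n⟩ : IFas)) ∈ dihedralGroup x.n ∧
      tot d.toHom = act α (std x.n) := by
    cases α
    · refine ⟨⟨fun _ => false, Equiv.refl _⟩, ?_, ?_⟩
      · exact one_mem _
      · rw [tot_hyp]; rfl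
    · exact ⟨dihR _, Submonoid.subset_closure (by simp), tot_dihR _⟩
  obtain ⟨d, h1, h2⟩ := this
  obtain ⟨d', h3, h4⟩ := exists_mem_dihedralGroup_rotate d k h1
  exact isDihedral_of_tot f d' h3 (by rw [h4, h2, hk])

lemma IsDihedral.comp {x y z : IFas} {f : x ⟶ y} {g : y ⟶ z} (hf : IsDihedral f)
    (hg : IsDihedral g) : IsDihedral (f ≫ g) := by
  apply isDihedral_of_dih
  rw [tot_comp]
  refine ((dih_of_isDihedral hg).pull _).trans ?_
  rw [← tot_eq]
  exact dih_of_isDihedral hf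

lemma isDihedral_id (x : IFas) : IsDihedral (𝟙 x) :=
  isDihedral_of_dih (tot_id x ▸ Dih.refl _)

/-- Two labelled lists that agree up to rotation and `t`, and start with `0^1`, are equal. -/
lemma eq_of_dih {X : Type} {l l' : List (X × Bool)} {a : X} (hn : ((a, false) :: l).map Prod.fst |>.Nodup)
    (h : Dih ((a, false) :: l) ((a, false) :: l')) : (a, false) :: l = (a, false) :: l' := by
  obtain ⟨α, h⟩ := h
  have hn' : (((a, false) :: l).map Prod.fst).Nodup := hn
  cases α
  · obtain ⟨k, hk⟩ := h
    rw [act_false] at hk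
    have hd : ((a, false) :: l).Nodup := List.Nodup.of_map _ hn'
    have hlt : k % ((a, false) :: l).length < ((a, false) :: l).length :=
      Nat.mod_lt _ (by simp)
    have h0 : (((a, false) :: l).rotate k)[0]? = some (a, false) := by rw [hk]; rfl
    rw [List.getElem?_rotate (by simp), List.getElem?_eq_some_iff] at h0
    obtain ⟨h1, h2⟩ := h0
    have h3 := (hd.getElem_inj_iff (i := (0 + k) % ((a, false) :: l).length) (j := 0) (hi := h1)
      (hj := by simp)).1 h2
    rw [← hk, ← List.rotate_mod]
    rw [zero_add] at h3
    rw [h3, List.rotate_zero]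
  · exfalso
    have h1 : (a, true) ∈ (a, false) :: l := by
      rw [h.mem_iff]
      simp [act]
    simp only [List.mem_cons, Prod.mk.injEq, Bool.true_eq_false, and_false, false_or] at h1
    rw [List.map_cons, List.nodup_cons] at hn'
    exact hn'.1 (List.mem_map.2 ⟨(a, true), h1, rfl⟩)

lemma tot_hPlus {n : ℕ} (h : HPlus n) : ∃ l, tot h.toHom = (0, false) :: l := by
  rw [HPlus.toHom, tot_hyp, List.finRange_succ, List.map_cons]
  have h0 : h.1.perm.symm 0 = 0 := by rw [Equiv.symm_apply_eq, h.2.2]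
  rw [h0, h.2.1]
  exact ⟨_, rfl⟩

/-- Every morphism `g` is uniquely the composite of an element of `H⁺` followed by a morphism
of `ΔD`; this is the component in `H⁺`. -/
theorem existsUnique_hPlus {x y : IFas} (g : x ⟶ y) :
    ∃! h : HPlus x.n, ∃ a : x ⟶ y, IsDihedral a ∧
      g = CategoryStruct.comp (Y := x) h.toHom a := by
  have key : ∀ (h : HPlus x.n) (a : x ⟶ y), IsDihedral a →
      Dih (tot (CategoryStruct.comp (Y := x) h.toHom a)) (tot h.toHom) := by
    intro h a ha
    rw [tot_comp]
    refine ((dih_of_isDihedral ha).pull _).trans ?_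
    rw [← tot_eq (x := ⟨x.n⟩) (y := ⟨x.n⟩)]
    exact Dih.refl _
  refine existsUnique_of_exists_of_unique ?_ ?_
  · have : ∃ l, Dih (tot g) ((0, false) :: l) := by
      have h0 : (0 : Fin (x.n + 1)) ∈ (tot g).map Prod.fst :=
        (map_fst_tot_perm g).mem_iff.2 (List.mem_finRange _)
      have hr : ∀ (l : List (Fin (x.n + 1) × Bool)) p, p ∈ l → ∃ l', l.IsRotated (p :: l') := by
        intro l p hp
        obtain ⟨s, t, rfl⟩ := List.append_of_mem hp
        exact ⟨t ++ s, List.isRotated_append⟩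
      obtain ⟨⟨j, α⟩, hp, hj⟩ := List.mem_map.1 h0
      obtain rfl : j = 0 := hj
      obtain ⟨l', hl'⟩ := hr (act α (tot g)) (0, false) (by
        cases α
        · exact hp
        · simp [act, hp])
      refine ⟨l', Dih.symm ⟨α, hl'.symm⟩⟩
    obtain ⟨l, hl⟩ := this
    obtain ⟨h, hh⟩ := exists_hyp ((0, false) :: l) (by
      obtain ⟨α, hα⟩ := hl.symm
      exact ((hα.perm.map _).trans (map_fst_act _ _)).trans (map_fst_tot_perm g))
    have hz : h.perm.symm 0 = 0 ∧ h.sign (h.perm.symm 0) = false := by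
      rw [tot_hyp, List.finRange_succ, List.map_cons, List.cons_eq_cons] at hh
      exact ⟨congrArg Prod.fst hh.1, congrArg Prod.snd hh.1⟩
    refine ⟨⟨h, by rw [← hz.1]; exact hz.2, by rw [← Equiv.eq_symm_apply, hz.1]⟩,
      CategoryStruct.comp (Y := x) h.inv.toHom g, ?_, ?_⟩
    · apply isDihedral_of_dih
      rw [tot_comp]
      refine (hl.pull _).trans ?_
      rw [← hh, ← tot_comp (x := ⟨x.n⟩) (y := ⟨x.n⟩) (z := ⟨x.n⟩), h.inv_toHom, tot_id]
      exact Dih.refl _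
    · change g = h.toHom ≫ h.inv.toHom ≫ g
      rw [← Category.assoc, h.toHom_inv, Category.id_comp]
  · rintro h h' ⟨a, ha, e⟩ ⟨a', ha', e'⟩
    have h1 := (key h a ha).symm.trans (e ▸ e' ▸ key h' a' ha')
    apply Subtype.ext
    apply tot_hyp_injective
    obtain ⟨l, hl⟩ := tot_hPlus h
    obtain ⟨l', hl'⟩ := tot_hPlus h'
    rw [hl, hl'] at h1
    have hn := (map_fst_tot_perm h.toHom).nodup_iff.2 (List.nodup_finRange _)
    rw [hl] at hn
    exact hl.trans ((eq_of_dih hn h1).trans hl'.symm)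

/-- The component in `H⁺` of `g = a ∘ h`, where `h` is in `H⁺` and `a` is in `ΔD`. -/
noncomputable def hPlusPart {x y : IFas} (g : x ⟶ y) : HPlus x.n :=
  (existsUnique_hPlus g).choose

lemma hPlusPart_spec {x y : IFas} (g : x ⟶ y) :
    ∃ a : x ⟶ y, IsDihedral a ∧ g = CategoryStruct.comp (Y := x) (hPlusPart g).toHom a :=
  (existsUnique_hPlus g).choose_spec.1

lemma hPlusPart_eq {x y : IFas} (h : HPlus x.n) {a : x ⟶ y} (ha : IsDihedral a) :
    hPlusPart (CategoryStruct.comp (Y := x) h.toHom a) = h :=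
  ((existsUnique_hPlus _).choose_spec.2 h ⟨a, ha, rfl⟩).symm

variable (k : Type u) [CommRing k]

/-- The functor `B`: it sends `[n]` to the free `k`-module on `H⁺_{n+1}` (all morphisms of the
groupoid `H⁺` at `[n]` are automorphisms), and `f : [n'] → [n]` to the map sending a basis
element `h` to the component in `H⁺` of `h ∘ f` under the decomposition `ΔD ∘ H⁺`. -/
noncomputable def functorB : IFasᵒᵖ ⥤ ModuleCat.{u} k where
  obj x := ModuleCat.of k (HPlus x.unop.n →₀ k)
  map {x y} f := ModuleCat.ofHom (Finsupp.lmapDomain k k fun h : HPlus x.unop.n =>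
    hPlusPart (CategoryStruct.comp (Z := x.unop) f.unop h.toHom))
  map_id x := by
    have : (fun h : HPlus x.unop.n =>
        hPlusPart (CategoryStruct.comp (Z := x.unop) (𝟙 x).unop h.toHom)) = fun h => h := by
      funext h
      have := hPlusPart_eq (x := x.unop) (y := x.unop) h (isDihedral_id x.unop)
      rw [Category.comp_id] at this
      rw [unop_id, Category.id_comp]
      exact this
    rw [this]
    apply ModuleCat.hom_ext
    exact Finsupp.lmapDomain_id k k
  map_comp {x y z} f g := by
    have : (fun h : HPlus x.unop.n =>
        hPlusPart (CategoryStruct.comp (Z := x.unop) (f ≫ g).unop h.toHom)) =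
        (fun h : HPlus y.unop.n =>
          hPlusPart (CategoryStruct.comp (Z := y.unop) g.unop h.toHom)) ∘
        (fun h : HPlus x.unop.n =>
          hPlusPart (CategoryStruct.comp (Z := x.unop) f.unop h.toHom)) := by
      funext h
      obtain ⟨a, ha, e⟩ := hPlusPart_spec (CategoryStruct.comp (Z := x.unop) f.unop h.toHom)
      simp only [Function.comp_apply]
      generalize hPlusPart (CategoryStruct.comp (Z := x.unop) f.unop h.toHom) = h' at e ⊢
      obtain ⟨a', ha', e'⟩ := hPlusPart_spec (CategoryStruct.comp (Z := y.unop) g.unop h'.toHom)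
      generalize hPlusPart (CategoryStruct.comp (Z := y.unop) g.unop h'.toHom) = h'' at e' ⊢
      have : CategoryStruct.comp (Z := x.unop) (f ≫ g).unop h.toHom =
          CategoryStruct.comp (Y := z.unop) h''.toHom (a' ≫ a) := by
        rw [unop_comp, Category.assoc, e, ← Category.assoc, e', Category.assoc]
      rw [this]
      exact hPlusPart_eq _ (ha'.comp ha)
    rw [this]
    apply ModuleCat.hom_ext
    exact Finsupp.lmapDomain_comp k k _ _

/-- The restriction `B'` of `B` to based involutive non-commutative sets. -/
noncomputable def functorBPrime : IGammaAsᵒᵖ ⥤ ModuleCat.{u} k :=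
  (wideSubcategoryInclusion IsBased).op ⋙ functorB k

end InvolutiveNoncommutativeSets
section InvolutiveAlgebras

/-- An involutive `k`-algebra: an associative unital `k`-algebra with an additive involution
`a ↦ star a` such that `star (a * b) = star b * star a` and which fixes the scalars. -/
class InvolutiveAlgebra (k A : Type*) [CommRing k] [Ring A] [Algebra k A] extends StarRing A where
  star_algebraMap : ∀ r : k, Star.star (algebraMap k A r) = algebraMap k A r

/-- An involutive `A`-bimodule: an `A`-bimodule (the right action of `a` is the action of
`MulOpposite.op a`) with an additive involution such that
`star (a m b) = (star b) (star m) (star a)`. -/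
class InvolutiveBimodule (A M : Type*) [Ring A] [StarRing A] [AddCommGroup M] [Module A M]
    [Module Aᵐᵒᵖ M] extends StarAddMonoid M where
  star_smul_smul : ∀ (a b : A) (m : M), Star.star (a • (MulOpposite.op b • m)) =
    Star.star b • (MulOpposite.op (Star.star a) • Star.star m)

variable (k A M : Type u) [CommRing k] [Ring A] [Algebra k A] [InvolutiveAlgebra k A]
  [AddCommGroup M] [Module k M] [Module A M] [Module Aᵐᵒᵖ M] [SMulCommClass A Aᵐᵒᵖ M]
  [IsScalarTower k A M] [IsScalarTower k Aᵐᵒᵖ M]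

/-- The `k`-module `M ⊗ A^{⊗ n}`. -/
abbrev TensorMod (n : ℕ) : Type u := TensorProduct k M (PiTensorProduct k fun _ : Fin n => A)

variable {k A M}

set_option linter.unusedSectionVars false

/-- The pure tensor `m ⊗ a_1 ⊗ ⋯ ⊗ a_n`, where `a_{j+1}` is `a j`. -/
def pureTensor (k : Type u) {A M : Type u} [CommRing k] [Ring A] [Algebra k A] [AddCommGroup M]
    [Module k M] {n : ℕ} (m : M) (a : Fin n → A) : TensorMod k A M n :=
  TensorProduct.tmul k m (PiTensorProduct.tprod k a)

lemma hom_ext_pureTensor {n : ℕ} {N : Type u} [AddCommGroup N] [Module k N]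
    {f g : TensorMod k A M n →ₗ[k] N}
    (h : ∀ m (a : Fin n → A), f (pureTensor k m a) = g (pureTensor k m a)) : f = g := by
  apply TensorProduct.ext
  ext m a
  exact h m a

/-! ### Linear maps of tensor products given by a formula on pure tensors -/

/-- `g` is linear in the variable `j`. -/
def LinAt (k : Type u) {A W : Type u} [CommRing k] [Ring A] [Algebra k A] [AddCommGroup W]
    [Module k W] {n : ℕ} (j : Fin n) (g : (Fin n → A) → W) : Prop :=
  ∀ a, IsLinearMap k fun x => g (Function.update a j x)

/-- `g` does not depend on the variable `j`. -/
def ConstAt {A W : Type u} {n : ℕ} (j : Fin n) (g : (Fin n → A) → W) : Prop :=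
  ∀ a x, g (Function.update a j x) = g a

/-- Every variable occurs in exactly one of `b0, b_1, …, b_m`, and there linearly. -/
def SlotCond (k : Type u) {A M : Type u} [CommRing k] [Ring A] [Algebra k A] [AddCommGroup M]
    [Module k M] {n m : ℕ} (b0 : (Fin n → A) → M →ₗ[k] M) (b : Fin m → (Fin n → A) → A) : Prop :=
  ∀ j, (LinAt k j b0 ∧ ∀ i, ConstAt j (b i)) ∨
    (ConstAt j b0 ∧ ∃ i, LinAt k j (b i) ∧ ∀ i', i' ≠ i → ConstAt j (b i'))

/-- The multilinear map `a ↦ (x ↦ b0(a)(x) ⊗ b_1(a) ⊗ ⋯ ⊗ b_m(a))`. -/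
noncomputable def slotMultilinear {n m : ℕ} (b0 : (Fin n → A) → M →ₗ[k] M)
    (b : Fin m → (Fin n → A) → A) (h : SlotCond k b0 b) :
    MultilinearMap k (fun _ : Fin n => A) (M →ₗ[k] TensorMod k A M m) :=
  have key : ∀ (a : Fin n → A) (j : Fin n), IsLinearMap k fun x =>
      ((TensorProduct.mk k M (PiTensorProduct k fun _ : Fin m => A)).flip
        (PiTensorProduct.tprod k fun i => b i (Function.update a j x))) ∘ₗ
          b0 (Function.update a j x) := by
    intro a j
    rcases h j with ⟨h1, h2⟩ | ⟨h1, i, h2, h3⟩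
    · have e : ∀ x, (fun i => b i (Function.update a j x)) = fun i => b i a :=
        fun x => funext fun i => h2 i a x
      simp only [e]
      constructor
      · intro x y
        rw [(h1 a).map_add, LinearMap.comp_add]
      · intro c x
        rw [(h1 a).map_smul, LinearMap.comp_smul]
    · have e0 : ∀ x, b0 (Function.update a j x) = b0 a := fun x => h1 a x
      have e : ∀ x, (fun i => b i (Function.update a j x)) =
          Function.update (fun i => b i a) i (b i (Function.update a j x)) := by
        intro x
        funext i'
        by_cases hi : i' = i
        · subst hi; simp
        · rw [Function.update_of_ne hi]
          exact h3 i' hi a x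
      simp only [e, e0]
      constructor
      · intro x y
        rw [(h2 a).map_add, MultilinearMap.map_update_add, map_add, LinearMap.add_comp]
      · intro c x
        rw [(h2 a).map_smul, MultilinearMap.map_update_smul, map_smul, LinearMap.smul_comp]
  MultilinearMap.mk'
    (fun a => ((TensorProduct.mk k M (PiTensorProduct k fun _ : Fin m => A)).flip
      (PiTensorProduct.tprod k fun i => b i a)) ∘ₗ b0 a)
    (fun a j x y => (key a j).map_add x y) (fun a j c x => (key a j).map_smul c x)

/-- The `k`-linear map `x ⊗ a_1 ⊗ ⋯ ⊗ a_n ↦ b0(a)(x) ⊗ b_1(a) ⊗ ⋯ ⊗ b_m(a)`. -/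
noncomputable def slotMap {n m : ℕ} (b0 : (Fin n → A) → M →ₗ[k] M)
    (b : Fin m → (Fin n → A) → A) (h : SlotCond k b0 b) :
    TensorMod k A M n →ₗ[k] TensorMod k A M m :=
  TensorProduct.lift (PiTensorProduct.lift (slotMultilinear b0 b h)).flip

lemma slotMap_pureTensor {n m : ℕ} (b0 : (Fin n → A) → M →ₗ[k] M)
    (b : Fin m → (Fin n → A) → A) (h : SlotCond k b0 b) (x : M) (a : Fin n → A) :
    slotMap b0 b h (pureTensor k x a) = pureTensor k (b0 a x) (fun i => b i a) := by
  simp [slotMap, pureTensor, slotMultilinear]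

section
variable {W : Type u} [Ring W] [Algebra k W] {n : ℕ} {j : Fin n}

lemma LinAt.mul {f g : (Fin n → A) → W} (hf : LinAt k j f) (hg : ConstAt j g) :
    LinAt k j fun a => f a * g a := by
  intro a
  have e : ∀ x, g (Function.update a j x) = g a := fun x => hg a x
  simp only [e]
  exact ⟨fun x y => by rw [(hf a).map_add, add_mul],
    fun c x => by rw [(hf a).map_smul, smul_mul_assoc]⟩

lemma LinAt.mul' {f g : (Fin n → A) → W} (hf : ConstAt j f) (hg : LinAt k j g) :
    LinAt k j fun a => f a * g a := by
  intro a
  have e : ∀ x, f (Function.update a j x) = f a := fun x => hf a x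
  simp only [e]
  exact ⟨fun x y => by rw [(hg a).map_add, mul_add],
    fun c x => by rw [(hg a).map_smul, mul_smul_comm]⟩

lemma ConstAt.mul {f g : (Fin n → A) → W} (hf : ConstAt j f) (hg : ConstAt j g) :
    ConstAt j fun a => f a * g a := fun a x => by
  simp only [hf a x, hg a x]

lemma LinAt.comp {V V' : Type u} [AddCommGroup V] [Module k V] [AddCommGroup V'] [Module k V']
    {f : (Fin n → A) → V} (hf : LinAt k j f) (φ : V →ₗ[k] V') : LinAt k j fun a => φ (f a) :=
  fun a => ⟨fun x y => (congrArg φ ((hf a).map_add x y)).trans (map_add φ _ _),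
    fun c x => (congrArg φ ((hf a).map_smul c x)).trans (map_smul φ _ _)⟩

lemma ConstAt.comp {V V' : Type u} {f : (Fin n → A) → V} (hf : ConstAt j f) (φ : V → V') :
    ConstAt j fun a => φ (f a) := fun a x => congrArg φ (hf a x)

lemma linAt_apply (j : Fin n) : LinAt k j fun a : Fin n → A => a j :=
  fun a => ⟨fun x y => by simp, fun c x => by simp⟩

lemma constAt_apply {i j : Fin n} (h : i ≠ j) : ConstAt j fun a : Fin n → A => a i :=
  fun _ _ => Function.update_of_ne h _ _

lemma constAt_const {V : Type u} (j : Fin n) (v : V) : ConstAt j fun _ : Fin n → A => v :=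
  fun _ _ => rfl

lemma constAt_prod {X Y : Type} (κ : X → Y) (y : Y) (v : X → (Fin n → A) → W)
    (hc : ∀ x, κ x ≠ y → ConstAt j (v x)) (l : List X) (hl : y ∉ l.map κ) :
    ConstAt j fun a => (l.map fun x => v x a).prod := by
  induction l with
  | nil => exact constAt_const _ _
  | cons x l ih =>
    simp only [List.map_cons, List.mem_cons, not_or, List.prod_cons] at hl ⊢
    exact (hc x (Ne.symm hl.1)).mul (ih hl.2)

lemma linAt_prod {X Y : Type} (κ : X → Y) (y : Y) (v : X → (Fin n → A) → W)
    (hc : ∀ x, κ x ≠ y → ConstAt j (v x)) (hv : ∀ x, κ x = y → LinAt k j (v x)) (l : List X)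
    (hn : (l.map κ).Nodup) (hl : y ∈ l.map κ) :
    LinAt k j fun a => (l.map fun x => v x a).prod := by
  induction l with
  | nil => simp at hl
  | cons x l ih =>
    rw [List.map_cons, List.nodup_cons] at hn
    simp only [List.map_cons, List.prod_cons]
    by_cases hx : κ x = y
    · exact (hv x hx).mul (constAt_prod κ y v hc l (hx ▸ hn.1))
    · exact LinAt.mul' (hc x hx) (ih hn.2 (by simpa [Ne.symm hx] using hl))

end

/-- Left multiplication by `a` on `M`. -/
noncomputable def leftMul (k : Type u) {A : Type u} (M : Type u) [CommRing k] [Ring A]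
    [Algebra k A] [AddCommGroup M] [Module k M] [Module A M] [IsScalarTower k A M] :
    A →ₗ[k] Module.End k M := (Algebra.lsmul k k M : A →ₐ[k] Module.End k M).toLinearMap

/-- Right multiplication by `a` on `M`. -/
noncomputable def rightMul (k : Type u) {A : Type u} (M : Type u) [CommRing k] [Ring A]
    [Algebra k A] [AddCommGroup M] [Module k M] [Module Aᵐᵒᵖ M] [IsScalarTower k Aᵐᵒᵖ M] :
    A →ₗ[k] Module.End k M :=
  (Algebra.lsmul k k M : Aᵐᵒᵖ →ₐ[k] Module.End k M).toLinearMap ∘ₗ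
    (MulOpposite.opLinearEquiv k : A ≃ₗ[k] Aᵐᵒᵖ).toLinearMap

lemma leftMul_apply (a : A) (m : M) : leftMul k M a m = a • m := rfl

lemma rightMul_apply (a : A) (m : M) : rightMul k M a m = MulOpposite.op a • m := rfl

lemma star_smul_scalar (r : k) (a : A) : star (r • a) = r • star a := by
  rw [Algebra.smul_def, star_mul, InvolutiveAlgebra.star_algebraMap, Algebra.smul_def,
    Algebra.commutes]

/-- The involution of `A`, raised to a label: the identity for the label `1` and the involution
for the label `t`. -/
def conjA (k : Type u) {A : Type u} [CommRing k] [Ring A] [Algebra k A] [InvolutiveAlgebra k A]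
    (z : Bool) : A →ₗ[k] A :=
  if z then { toFun := star, map_add' := star_add, map_smul' := star_smul_scalar }
  else LinearMap.id

lemma conjA_true (a : A) : conjA k true a = star a := rfl

lemma conjA_false (a : A) : conjA k false a = a := rfl

variable [InvolutiveBimodule A M]

lemma star_smul_left (k : Type u) {A M : Type u} [CommRing k] [Ring A] [Algebra k A]
    [InvolutiveAlgebra k A] [AddCommGroup M] [Module A M] [Module Aᵐᵒᵖ M]
    [InvolutiveBimodule A M] (a : A) (m : M) :
    star (a • m) = MulOpposite.op (star a) • star m := by
  simpa using InvolutiveBimodule.star_smul_smul a 1 m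

lemma star_smul_right (k : Type u) {A M : Type u} [CommRing k] [Ring A] [Algebra k A]
    [InvolutiveAlgebra k A] [AddCommGroup M] [Module A M] [Module Aᵐᵒᵖ M]
    [InvolutiveBimodule A M] (a : A) (m : M) :
    star (MulOpposite.op a • m) = star a • star m := by
  simpa using InvolutiveBimodule.star_smul_smul 1 a m

/-- The involution of `M`, raised to a label. -/
def conjM (k A : Type u) {M : Type u} [CommRing k] [Ring A] [Algebra k A] [InvolutiveAlgebra k A]
    [AddCommGroup M] [Module k M] [Module A M] [Module Aᵐᵒᵖ M]
    [IsScalarTower k A M] [IsScalarTower k Aᵐᵒᵖ M] [InvolutiveBimodule A M]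
    (z : Bool) : M →ₗ[k] M :=
  if z then
    { toFun := star
      map_add' := star_add
      map_smul' := fun r m => by
        have h1 : r • m = algebraMap k A r • m := (algebraMap_smul A r m).symm
        have h2 : r • star m = MulOpposite.op (algebraMap k A r) • star m :=
          (algebraMap_smul Aᵐᵒᵖ r (star m)).symm
        rw [h1, star_smul_left k, InvolutiveAlgebra.star_algebraMap, RingHom.id_apply, h2] }
  else LinearMap.id

lemma conjM_true (m : M) : conjM k A true m = star m := rfl

lemma conjM_false (m : M) : conjM k A false m = m := rfl

/-! ### The functor `R(A, M)` -/

/-- The ordered product `∏ a_j^{z}` over the elements `j^z` of a labelled list (which in use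
does not contain `0`). -/
noncomputable def fiberProd (k : Type u) {A : Type u} [CommRing k] [Ring A] [Algebra k A]
    [InvolutiveAlgebra k A] {n : ℕ} (l : List (Fin (n + 1) × Bool)) (a : Fin n → A) : A :=
  (l.map fun p => conjA k p.2 ((Fin.cons 1 a : Fin (n + 1) → A) p.1)).prod

/-- The ordered product over the elements `j^z` of a labelled list containing `0`, where `0^z`
contributes `m^z` and `j^z` contributes `a_j^z` for `j > 0`; a `k`-linear map in `m`. -/
noncomputable def baseProd (k : Type u) {A : Type u} (M : Type u) [CommRing k] [Ring A]
    [Algebra k A] [InvolutiveAlgebra k A] [AddCommGroup M] [Module k M] [Module A M]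
    [Module Aᵐᵒᵖ M] [IsScalarTower k A M] [IsScalarTower k Aᵐᵒᵖ M] [InvolutiveBimodule A M]
    {n : ℕ} : List (Fin (n + 1) × Bool) → (Fin n → A) → (M →ₗ[k] M)
  | [], _ => 0
  | (j, z) :: l, a =>
    if h : j = 0 then rightMul k M (fiberProd k l a) ∘ₗ conjM k A z
    else leftMul k M (conjA k z (a (j.pred h))) ∘ₗ baseProd k M l a

section
variable {n : ℕ}

lemma fiberProd_nil (a : Fin n → A) : fiberProd k [] a = 1 := rfl

lemma fiberProd_cons (p : Fin (n + 1) × Bool) (l : List (Fin (n + 1) × Bool)) (a : Fin n → A) :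
    fiberProd k (p :: l) a =
      conjA k p.2 ((Fin.cons 1 a : Fin (n + 1) → A) p.1) * fiberProd k l a := by
  simp [fiberProd]

lemma fiberProd_append (l l' : List (Fin (n + 1) × Bool)) (a : Fin n → A) :
    fiberProd k (l ++ l') a = fiberProd k l a * fiberProd k l' a := by
  simp [fiberProd]

lemma conjA_one (z : Bool) : conjA k z (1 : A) = 1 := by
  cases z
  · rfl
  · exact star_one A

lemma conjA_conjA (z w : Bool) (a : A) : conjA k z (conjA k w a) = conjA k (xor z w) a := by
  cases z <;> cases w <;> simp [conjA_true, conjA_false]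

lemma fiberProd_act (z : Bool) (l : List (Fin (n + 1) × Bool)) (a : Fin n → A) :
    fiberProd k (act z l) a = conjA k z (fiberProd k l a) := by
  cases z
  · rfl
  · induction l with
    | nil => exact (star_one A).symm
    | cons p l ih =>
      rw [show p :: l = [p] ++ l from rfl, act_true_append, fiberProd_append, ih,
        fiberProd_append, conjA_true, conjA_true, star_mul, act_singleton]
      congr 1
      simp only [fiberProd, List.map_cons, List.map_nil, List.prod_cons, List.prod_nil, mul_one]
      rw [← conjA_conjA, conjA_true]

lemma conjM_conjM (z w : Bool) (m : M) :
    conjM k A z (conjM k A w m) = conjM k A (xor z w) m := by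
  cases z <;> cases w <;> simp [conjM_true, conjM_false]

lemma baseProd_cons_zero (z : Bool) (l : List (Fin (n + 1) × Bool)) (a : Fin n → A) (m : M) :
    baseProd k M ((0, z) :: l) a m = MulOpposite.op (fiberProd k l a) • conjM k A z m := by
  simp [baseProd, rightMul_apply]

lemma baseProd_append {l : List (Fin (n + 1) × Bool)} (h : 0 ∉ l.map Prod.fst)
    (l' : List (Fin (n + 1) × Bool)) (a : Fin n → A) (m : M) :
    baseProd k M (l ++ l') a m = fiberProd k l a • baseProd k M l' a m := by
  induction l with
  | nil => simp [fiberProd]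
  | cons p l ih =>
    obtain ⟨j, z⟩ := p
    simp only [List.map_cons, List.mem_cons, not_or] at h
    have hj : j ≠ 0 := Ne.symm h.1
    rw [List.cons_append, baseProd, dif_neg hj, LinearMap.comp_apply, ih h.2, leftMul_apply,
      fiberProd_cons, mul_smul]
    congr 2
    obtain ⟨i, rfl⟩ := Fin.exists_succ_eq.2 hj
    simp

lemma exists_split {l : List (Fin (n + 1) × Bool)} (hn : (l.map Prod.fst).Nodup)
    (h0 : 0 ∈ l.map Prod.fst) : ∃ l₁ z l₂, l = l₁ ++ (0, z) :: l₂ ∧ 0 ∉ l₁.map Prod.fst ∧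
      0 ∉ l₂.map Prod.fst := by
  obtain ⟨⟨j, z⟩, hp, hj⟩ := List.mem_map.1 h0
  obtain rfl : j = 0 := hj
  obtain ⟨l₁, l₂, rfl⟩ := List.append_of_mem hp
  refine ⟨l₁, z, l₂, rfl, ?_, ?_⟩
  · rw [List.map_append, List.nodup_append'] at hn
    intro h
    exact hn.2.2 h (by simp)
  · rw [List.map_append, List.nodup_append', List.map_cons, List.nodup_cons] at hn
    exact hn.2.1.1

lemma baseProd_split {l₁ : List (Fin (n + 1) × Bool)} (h : 0 ∉ l₁.map Prod.fst) (z : Bool)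
    (l₂ : List (Fin (n + 1) × Bool)) (a : Fin n → A) (m : M) :
    baseProd k M (l₁ ++ (0, z) :: l₂) a m =
      fiberProd k l₁ a • (MulOpposite.op (fiberProd k l₂ a) • conjM k A z m) := by
  rw [baseProd_append h, baseProd_cons_zero]

lemma baseProd_act (z : Bool) {l : List (Fin (n + 1) × Bool)} (hn : (l.map Prod.fst).Nodup)
    (h0 : 0 ∈ l.map Prod.fst) (a : Fin n → A) (m : M) :
    baseProd k M (act z l) a m = conjM k A z (baseProd k M l a m) := by
  cases z
  · rfl
  · obtain ⟨l₁, w, l₂, rfl, h1, h2⟩ := exists_split hn h0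
    rw [baseProd_split h1, act_true_append, show (0, w) :: l₂ = [(0, w)] ++ l₂ from rfl,
      act_true_append, act_singleton, List.append_assoc, List.singleton_append,
      baseProd_split (by rwa [mem_map_fst_act]), fiberProd_act, fiberProd_act, conjM_true,
      InvolutiveBimodule.star_smul_smul, ← conjM_conjM, conjM_true, conjA_true, conjA_true]

lemma fiberProd_pull {m' : ℕ} (F : Fin (m' + 1) → List (Fin (n + 1) × Bool)) (a : Fin n → A)
    {l : List (Fin (m' + 1) × Bool)} (h : 0 ∉ l.map Prod.fst) :
    fiberProd k l (fun i : Fin m' => fiberProd k (F i.succ) a) = fiberProd k (pull F l) a := by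
  induction l with
  | nil => rfl
  | cons p l ih =>
    simp only [List.map_cons, List.mem_cons, not_or] at h
    rw [fiberProd_cons, ih h.2, pull_cons, fiberProd_append, fiberProd_act]
    obtain ⟨i, hi⟩ := Fin.exists_succ_eq.2 (Ne.symm h.1)
    rw [← hi]
    rfl

lemma zero_notMem_pull {m' : ℕ} (F : Fin (m' + 1) → List (Fin (n + 1) × Bool))
    (hF : ∀ i, i ≠ 0 → 0 ∉ (F i).map Prod.fst) {l : List (Fin (m' + 1) × Bool)}
    (h : 0 ∉ l.map Prod.fst) : 0 ∉ (pull F l).map Prod.fst := by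
  rw [mem_map_fst_pull]
  rintro ⟨y, h1, h2⟩
  exact hF y (fun e => h (e ▸ h1)) h2

lemma baseProd_pull {m' : ℕ} (F : Fin (m' + 1) → List (Fin (n + 1) × Bool)) (a : Fin n → A)
    (hF : ∀ i, i ≠ 0 → 0 ∉ (F i).map Prod.fst) (hF0 : ((F 0).map Prod.fst).Nodup)
    (hF0' : 0 ∈ (F 0).map Prod.fst)
    {l : List (Fin (m' + 1) × Bool)} (hn : (l.map Prod.fst).Nodup) (h : 0 ∈ l.map Prod.fst)
    (m : M) :
    baseProd k M l (fun i : Fin m' => fiberProd k (F i.succ) a) (baseProd k M (F 0) a m) =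
      baseProd k M (pull F l) a m := by
  obtain ⟨l₁, z, l₂, rfl, h1, h2⟩ := exists_split hn h
  rw [baseProd_split h1, pull_append, baseProd_append (zero_notMem_pull F hF h1), pull_cons,
    fiberProd_pull F a h1, fiberProd_pull F a h2]
  congr 1
  rw [← baseProd_act z hF0 hF0']
  obtain ⟨s, w, t, e, h3, h4⟩ := exists_split (l := act z (F 0))
    ((map_fst_act _ _).nodup_iff.2 hF0) (by rwa [mem_map_fst_act])
  simp only [e, List.append_assoc, List.cons_append]
  rw [baseProd_split h3, baseProd_split h3, fiberProd_append, MulOpposite.op_mul, mul_smul,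
    ← smul_comm (fiberProd k s a)]

lemma constAt_val {j : Fin n} (p : Fin (n + 1) × Bool) (h : p.1 ≠ j.succ) :
    ConstAt j fun a : Fin n → A => conjA k p.2 ((Fin.cons 1 a : Fin (n + 1) → A) p.1) := by
  apply ConstAt.comp (f := fun a : Fin n → A => (Fin.cons 1 a : Fin (n + 1) → A) p.1)
  by_cases h0 : p.1 = 0
  · rw [h0]; exact constAt_const _ _
  · obtain ⟨i, hi⟩ := Fin.exists_succ_eq.2 h0
    rw [← hi] at h ⊢
    exact constAt_apply fun e => h (e ▸ rfl)

lemma linAt_val {j : Fin n} (p : Fin (n + 1) × Bool) (h : p.1 = j.succ) :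
    LinAt k j fun a : Fin n → A => conjA k p.2 ((Fin.cons 1 a : Fin (n + 1) → A) p.1) := by
  apply LinAt.comp (f := fun a : Fin n → A => (Fin.cons 1 a : Fin (n + 1) → A) p.1)
  rw [h]
  exact linAt_apply j

lemma constAt_fiberProd {j : Fin n} (l : List (Fin (n + 1) × Bool))
    (hl : j.succ ∉ l.map Prod.fst) : ConstAt j fun a : Fin n → A => fiberProd k l a :=
  constAt_prod Prod.fst j.succ _ (fun p hp => constAt_val p hp) l hl

lemma linAt_fiberProd {j : Fin n} (l : List (Fin (n + 1) × Bool)) (hn : (l.map Prod.fst).Nodup)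
    (hl : j.succ ∈ l.map Prod.fst) : LinAt k j fun a : Fin n → A => fiberProd k l a :=
  linAt_prod Prod.fst j.succ _ (fun p hp => constAt_val p hp) (fun p hp => linAt_val p hp) l hn hl

lemma constAt_baseProd {j : Fin n} (l : List (Fin (n + 1) × Bool))
    (hl : j.succ ∉ l.map Prod.fst) : ConstAt j fun a : Fin n → A => baseProd k M l a := by
  induction l with
  | nil => exact constAt_const _ _
  | cons p l ih =>
    obtain ⟨i, z⟩ := p
    simp only [List.map_cons, List.mem_cons, not_or] at hl
    simp only [baseProd]
    split_ifs with h
    · exact ((constAt_fiberProd l hl.2).comp _).mul (W := Module.End k M) (constAt_const _ _)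
    · refine ConstAt.mul (W := Module.End k M) (ConstAt.comp (f := fun a : Fin n → A => a (i.pred h))
        (constAt_apply ?_) fun x => leftMul k M (conjA k z x)) (ih hl.2)
      rintro rfl
      simp at hl

lemma linAt_baseProd {j : Fin n} (l : List (Fin (n + 1) × Bool)) (hn : (l.map Prod.fst).Nodup)
    (hl : j.succ ∈ l.map Prod.fst) (h0 : 0 ∈ l.map Prod.fst) :
    LinAt k j fun a : Fin n → A => baseProd k M l a := by
  induction l with
  | nil => simp at hl
  | cons p l ih =>
    obtain ⟨i, z⟩ := p
    rw [List.map_cons, List.nodup_cons] at hn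
    simp only [List.map_cons, List.mem_cons] at hl h0
    simp only [baseProd]
    split_ifs with h
    · subst h
      have hl' : j.succ ∈ l.map Prod.fst := hl.resolve_left (Fin.succ_ne_zero j)
      exact LinAt.mul (W := Module.End k M) ((linAt_fiberProd l hn.2 hl').comp (rightMul k M))
        (constAt_const _ _)
    · by_cases hi : j.succ = i
      · subst hi
        refine LinAt.mul (W := Module.End k M) (LinAt.comp (f := fun a : Fin n → A =>
          a (j.succ.pred h)) ?_ (leftMul k M ∘ₗ conjA k z)) (constAt_baseProd l hn.1)
        simp only [Fin.pred_succ]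
        exact linAt_apply j
      · refine LinAt.mul' (W := Module.End k M) (ConstAt.comp (f := fun a : Fin n → A =>
          a (i.pred h)) (constAt_apply ?_) fun x => leftMul k M (conjA k z x))
          (ih hn.2 (hl.resolve_left hi) (h0.resolve_left (Ne.symm h)))
        rintro rfl
        simp at hi

end

lemma based_zero {x y : IGammaAs} (f : x ⟶ y) : IFHom.toFun f.hom 0 = 0 := f.property

lemma slotCond_based {x y : IGammaAs} (f : x ⟶ y) :
    SlotCond k (fun a : Fin x.obj.n → A => baseProd k M (IFHom.fiber f.hom 0) a)
      (fun (i : Fin y.obj.n) a => fiberProd k (IFHom.fiber f.hom i.succ) a) := by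
  intro j
  by_cases h : IFHom.toFun f.hom j.succ = 0
  · refine Or.inl ⟨linAt_baseProd _ (IFHom.nodup _ _) ((IFHom.mem_fiber _ _ _).2 h)
      ((IFHom.mem_fiber _ _ _).2 (based_zero f)), fun i => constAt_fiberProd _ ?_⟩
    rw [IFHom.mem_fiber, h]
    exact (Fin.succ_ne_zero i).symm
  · refine Or.inr ⟨constAt_baseProd _ (by rwa [IFHom.mem_fiber]), ?_⟩
    obtain ⟨i, hi⟩ := Fin.exists_succ_eq.2 h
    refine ⟨i, linAt_fiberProd _ (IFHom.nodup _ _) ((IFHom.mem_fiber _ _ _).2 hi.symm), ?_⟩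
    intro i' hne
    apply constAt_fiberProd
    rw [IFHom.mem_fiber, ← hi]
    exact fun e => hne (Fin.succ_injective _ e).symm

/-- The map `a_0 ⊗ ⋯ ⊗ a_n ↦ b_0 ⊗ ⋯ ⊗ b_m` (with `a_0 ∈ M`), where `b_i` is the ordered product
of the `a_j^{z_j}` over the fibre `f⁻¹(i)`. -/
noncomputable def mapR {x y : IGammaAs} (f : x ⟶ y) :
    TensorMod k A M x.obj.n →ₗ[k] TensorMod k A M y.obj.n :=
  slotMap (fun a : Fin x.obj.n → A => baseProd k M (IFHom.fiber f.hom 0) a)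
    (fun (i : Fin y.obj.n) a => fiberProd k (IFHom.fiber f.hom i.succ) a) (slotCond_based f)

lemma mapR_pureTensor {x y : IGammaAs} (f : x ⟶ y) (m : M) (a : Fin x.obj.n → A) :
    mapR f (pureTensor k m a) = pureTensor k (baseProd k M (IFHom.fiber f.hom 0) a m)
      (fun i : Fin y.obj.n => fiberProd k (IFHom.fiber f.hom i.succ) a) :=
  slotMap_pureTensor _ _ _ m a

lemma mapR_id (x : IGammaAs) : mapR (k := k) (A := A) (M := M) (𝟙 x) = LinearMap.id := by
  apply hom_ext_pureTensor
  intro m a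
  rw [mapR_pureTensor]
  refine congrArg₂ (pureTensor k) ?_ ?_
  · exact (baseProd_cons_zero false [] a m).trans (by simp [fiberProd, conjM_false])
  · funext i
    exact mul_one (a i)

lemma mapR_comp {x y z : IGammaAs} (f : x ⟶ y) (g : y ⟶ z) :
    mapR (k := k) (A := A) (M := M) (f ≫ g) = mapR g ∘ₗ mapR f := by
  apply hom_ext_pureTensor
  intro m a
  rw [LinearMap.comp_apply, mapR_pureTensor, mapR_pureTensor, mapR_pureTensor]
  have h0 : ∀ {x y : IGammaAs} (f : x ⟶ y), 0 ∈ (IFHom.fiber f.hom 0).map Prod.fst :=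
    fun f => (IFHom.mem_fiber _ _ _).2 (based_zero f)
  refine congrArg₂ (pureTensor k) ?_ ?_
  · refine (baseProd_pull (IFHom.fiber f.hom) a ?_ (IFHom.nodup _ _) (h0 f) (IFHom.nodup _ _)
      (h0 g) m).symm
    intro i hi h
    rw [IFHom.mem_fiber, based_zero] at h
    exact hi h.symm
  · funext i
    refine (fiberProd_pull (IFHom.fiber f.hom) a ?_).symm
    rw [IFHom.mem_fiber, based_zero]
    exact (Fin.succ_ne_zero i).symm

variable (k A M) in
/-- The functor `R(A, M)` with values `M ⊗ A^{⊗ n}` at `[n]`. -/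
noncomputable def functorR : IGammaAs ⥤ ModuleCat.{u} k where
  obj x := ModuleCat.of k (TensorMod k A M x.obj.n)
  map f := ModuleCat.ofHom (mapR f)
  map_id x := by rw [mapR_id]; rfl
  map_comp f g := by rw [mapR_comp]; rfl

/-! ### The reflexive category and the Loday functor -/

/-- A morphism `(φ, g) : [n] → [m]` of `ΔR`: an order-preserving map `φ : [n] → [m]` and an
element `g` of the reflexive group `{1, r}` (`refl = true` means `g = r`). It stands for the
composite `φ ∘ g`. -/
@[ext] structure DeltaRHom (n m : ℕ) where
  map : Fin (n + 1) →o Fin (m + 1)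
  refl : Bool

/-- `r ∘ φ ∘ r`, where `r(i) = n - i`, if `g = r`, and `φ` if `g = 1`. -/
def revConj {n m : ℕ} (g : Bool) (φ : Fin (n + 1) →o Fin (m + 1)) : Fin (n + 1) →o Fin (m + 1) :=
  if g then ⟨fun i => (φ i.rev).rev, fun _ _ h => Fin.rev_le_rev.2 (φ.monotone
    (Fin.rev_le_rev.2 h))⟩ else φ

/-- The reflexive category `ΔR`; `⟨n⟩` is the set `[n]`. -/
structure DeltaR where
  n : ℕ

lemma revConj_true {n m : ℕ} (φ : Fin (n + 1) →o Fin (m + 1)) (i : Fin (n + 1)) :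
    revConj true φ i = (φ i.rev).rev := rfl

lemma revConj_false {n m : ℕ} (φ : Fin (n + 1) →o Fin (m + 1)) : revConj false φ = φ := rfl

lemma revConj_comp {n m p : ℕ} (g : Bool) (φ : Fin (n + 1) →o Fin (m + 1))
    (ψ : Fin (m + 1) →o Fin (p + 1)) :
    revConj g (ψ.comp φ) = (revConj g ψ).comp (revConj g φ) := by
  cases g
  · rfl
  · ext i
    simp [revConj_true]

lemma revConj_revConj {n m : ℕ} (g h : Bool) (φ : Fin (n + 1) →o Fin (m + 1)) :
    revConj g (revConj h φ) = revConj (xor g h) φ := by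
  cases g <;> cases h <;> ext i <;> simp [revConj_true, revConj_false]

/-- The composite of `(φ, g)` followed by `(ψ, h)` is `ψ h φ g = ψ (h φ h⁻¹) h g`. -/
instance : SmallCategory DeltaR where
  Hom x y := DeltaRHom x.n y.n
  id x := ⟨OrderHom.id, false⟩
  comp f g := ⟨g.map.comp (revConj g.refl f.map), xor g.refl f.refl⟩
  id_comp f := by
    apply DeltaRHom.ext
    · ext i
      cases f.refl <;> simp [revConj_true, revConj_false]
    · simp
  comp_id f := by
    apply DeltaRHom.ext
    · rfl
    · simp
  assoc f g h := by
    apply DeltaRHom.ext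
    · simp only [revConj_comp, revConj_revConj, OrderHom.comp_assoc]
    · simp

/-- The product `a_{s+1} a_{s+2} ⋯ a_t` (where `a_{j+1}` is `a j`). -/
def segProd {A : Type u} [Ring A] {n : ℕ} (a : Fin n → A) (s t : ℕ) : A :=
  ((List.range' s (t - s)).map fun j => if h : j < n then a ⟨j, h⟩ else 1).prod

section
variable {n : ℕ}

lemma segProd_self (a : Fin n → A) (s : ℕ) : segProd a s s = 1 := by
  simp [segProd]

lemma segProd_mul (a : Fin n → A) {s t w : ℕ} (h : s ≤ t) (h' : t ≤ w) :
    segProd a s t * segProd a t w = segProd a s w := by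
  rw [segProd, segProd, segProd, ← List.prod_append, ← List.map_append]
  congr 2
  have := List.range'_append (s := s) (m := t - s) (n := w - t) (step := 1)
  rw [one_mul, Nat.add_sub_cancel' h] at this
  rw [this]
  congr 1
  omega

lemma segProd_succ (a : Fin n → A) (j : Fin n) : segProd a j (j + 1) = a j := by
  simp [segProd]

lemma segProd_succ_right (a : Fin n → A) {s t : ℕ} (h : s ≤ t) (ht : t < n) :
    segProd a s (t + 1) = segProd a s t * a ⟨t, ht⟩ := by
  rw [← segProd_mul a h (Nat.le_succ t), ← segProd_succ a ⟨t, ht⟩]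

lemma linAt_segProd {j : Fin n} {s t : ℕ} (h : s ≤ j) (h' : j < t) :
    LinAt k j fun a : Fin n → A => segProd a s t := by
  refine linAt_prod (fun x : ℕ => x) (j : ℕ)
    (fun (x : ℕ) (a : Fin n → A) => if h : x < n then a ⟨x, h⟩ else 1) ?_ ?_ _ ?_ ?_
  · intro x hx
    by_cases hxn : x < n
    · simp only [hxn, dif_pos]
      exact constAt_apply fun e => hx (congrArg Fin.val e)
    · simp only [hxn, dif_neg, not_false_eq_true]
      exact constAt_const _ _
  · rintro x rfl
    simp only [j.2, dif_pos]
    exact linAt_apply j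
  · simp [List.nodup_range']
  · simp only [List.map_id', List.mem_range'_1]
    omega

lemma constAt_segProd {j : Fin n} {s t : ℕ} (h : (j : ℕ) < s ∨ t ≤ j) :
    ConstAt j fun a : Fin n → A => segProd a s t := by
  refine constAt_prod (fun x : ℕ => x) (j : ℕ)
    (fun (x : ℕ) (a : Fin n → A) => if h : x < n then a ⟨x, h⟩ else 1) ?_ _ ?_
  · intro x hx
    by_cases hxn : x < n
    · simp only [hxn, dif_pos]
      exact constAt_apply fun e => hx (congrArg Fin.val e)
    · simp only [hxn, dif_neg, not_false_eq_true]
      exact constAt_const _ _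
  · simp only [List.map_id', List.mem_range'_1]
    omega

lemma segProd_telescope {m : ℕ} (a : Fin n → A) (φ : Fin (m + 1) →o Fin (n + 1))
    {s t : ℕ} (h : s ≤ t) (ht : t < m + 1) :
    segProd (fun j : Fin m => segProd a (φ j.castSucc) (φ j.succ)) s t =
      segProd a (φ ⟨s, h.trans_lt ht⟩) (φ ⟨t, ht⟩) := by
  induction t, h using Nat.le_induction with
  | base => rw [segProd_self, segProd_self]
  | succ t h ih =>
    rw [segProd_succ_right _ h (Nat.lt_of_succ_lt_succ ht), ih (by omega)]
    exact segProd_mul a (φ.monotone (by simpa using h)) (φ.monotone (by simp))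

lemma star_segProd (a : Fin n → A) {s t : ℕ} (h : s ≤ t) (ht : t ≤ n) :
    star (segProd a s t) = segProd (fun j => star (a j.rev)) (n - t) (n - s) := by
  induction t, h using Nat.le_induction with
  | base => rw [segProd_self, segProd_self, star_one]
  | succ t h ih =>
    rw [segProd_succ_right _ h ht, star_mul, ih (by omega),
      ← segProd_mul _ (show n - (t + 1) ≤ n - t by omega) (by omega)]
    congr 1
    have := segProd_succ (fun j => star (a j.rev)) (⟨t, ht⟩ : Fin n).rev
    simp only [Fin.rev_rev, Fin.val_rev] at this
    rw [← this]
    congr 1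
    omega

end

lemma slotCond_loday {n m : ℕ} (φ : Fin (m + 1) →o Fin (n + 1)) :
    SlotCond k (fun a : Fin n → A => leftMul k M (segProd a (φ (Fin.last m)) n) ∘ₗ
        rightMul k M (segProd a 0 (φ 0)))
      (fun (i : Fin m) a => segProd a (φ i.castSucc) (φ i.succ)) := by
  intro j
  by_cases h0 : (j : ℕ) < φ 0
  · refine Or.inl ⟨LinAt.mul' (W := Module.End k M) ?_ ?_, fun i => constAt_segProd (Or.inl ?_)⟩
    · refine ConstAt.comp (constAt_segProd (Or.inl ?_)) (leftMul k M)
      exact h0.trans_le (φ.monotone (Fin.zero_le _))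
    · exact LinAt.comp (linAt_segProd (Nat.zero_le _) h0) (rightMul k M)
    · exact h0.trans_le (φ.monotone (Fin.zero_le _))
  by_cases h1 : (φ (Fin.last m) : ℕ) ≤ j
  · refine Or.inl ⟨LinAt.mul (W := Module.End k M) ?_ ?_, fun i => constAt_segProd (Or.inr ?_)⟩
    · exact LinAt.comp (linAt_segProd h1 j.2) (leftMul k M)
    · exact ConstAt.comp (constAt_segProd (Or.inr (not_lt.1 h0))) (rightMul k M)
    · exact le_trans (φ.monotone (Fin.le_last _)) h1
  · refine Or.inr ⟨ConstAt.mul (W := Module.End k M) ?_ ?_, ?_⟩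
    · exact ConstAt.comp (constAt_segProd (Or.inl (not_le.1 h1))) (leftMul k M)
    · exact ConstAt.comp (constAt_segProd (Or.inr (not_lt.1 h0))) (rightMul k M)
    have key : ∃ i : Fin m, (φ i.castSucc : ℕ) ≤ j ∧ (j : ℕ) < φ i.succ := by
      by_contra hc
      push Not at hc
      have : ∀ i : Fin (m + 1), (φ i : ℕ) ≤ j := by
        intro i
        induction i using Fin.induction with
        | zero => exact not_lt.1 h0
        | succ i ih => exact hc i ih
      exact h1 (this _)
    obtain ⟨i, hi1, hi2⟩ := key
    refine ⟨i, linAt_segProd hi1 hi2, fun i' hne => constAt_segProd ?_⟩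
    rcases lt_or_gt_of_ne hne with h | h
    · right
      exact le_trans (φ.monotone (show i'.succ ≤ i.castSucc from h)) hi1
    · left
      exact lt_of_lt_of_le hi2 (φ.monotone (show i.succ ≤ i'.castSucc from h))

/-- The action of an order-preserving map `φ : [m] → [n]` on the Loday functor: the map
`M ⊗ A^{⊗ n} → M ⊗ A^{⊗ m}` sending `x ⊗ a_1 ⊗ ⋯ ⊗ a_n` to
`(a_{φ(m)+1} ⋯ a_n x a_1 ⋯ a_{φ(0)}) ⊗ b_1 ⊗ ⋯ ⊗ b_m` with `b_i = a_{φ(i-1)+1} ⋯ a_{φ(i)}`.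
Its values on the generators `δ_i` and `σ_j` of `Δ` are the face and degeneracy maps computed in
`lodayMap_face_zero`, `lodayMap_face_middle`, `lodayMap_face_last`, `lodayMap_degeneracy`. -/
noncomputable def lodayMap {n m : ℕ} (φ : Fin (m + 1) →o Fin (n + 1)) :
    TensorMod k A M n →ₗ[k] TensorMod k A M m :=
  slotMap (fun a : Fin n → A => leftMul k M (segProd a (φ (Fin.last m)) n) ∘ₗ
    rightMul k M (segProd a 0 (φ 0)))
    (fun (i : Fin m) a => segProd a (φ i.castSucc) (φ i.succ)) (slotCond_loday φ)

lemma lodayMap_pureTensor {n m : ℕ} (φ : Fin (m + 1) →o Fin (n + 1)) (x : M) (a : Fin n → A) :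
    lodayMap φ (pureTensor k x a) = pureTensor k
      (segProd a (φ (Fin.last m)) n • (MulOpposite.op (segProd a 0 (φ 0)) • x))
      (fun i : Fin m => segProd a (φ i.castSucc) (φ i.succ)) :=
  slotMap_pureTensor _ _ _ x a

lemma lodayMap_id (n : ℕ) :
    lodayMap (k := k) (A := A) (M := M) (OrderHom.id : Fin (n + 1) →o Fin (n + 1)) =
      LinearMap.id := by
  apply hom_ext_pureTensor
  intro x a
  rw [lodayMap_pureTensor]
  refine congrArg₂ (pureTensor k) ?_ ?_
  · simp [segProd_self]
  · funext i
    exact segProd_succ a i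

lemma lodayMap_comp {n m p : ℕ} (φ : Fin (m + 1) →o Fin (n + 1)) (ψ : Fin (p + 1) →o Fin (m + 1)) :
    lodayMap (k := k) (A := A) (M := M) (φ.comp ψ) = lodayMap ψ ∘ₗ lodayMap φ := by
  apply hom_ext_pureTensor
  intro x a
  rw [LinearMap.comp_apply, lodayMap_pureTensor, lodayMap_pureTensor, lodayMap_pureTensor]
  have tele : ∀ s t : Fin (m + 1), s ≤ t →
      segProd (fun j : Fin m => segProd a (φ j.castSucc) (φ j.succ)) s t =
        segProd a (φ s) (φ t) := fun s t h => segProd_telescope a φ h t.2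
  refine congrArg₂ (pureTensor k) ?_ ?_
  · have h1 := tele (ψ (Fin.last p)) (Fin.last m) (Fin.le_last _)
    have h2 := tele 0 (ψ 0) (Fin.zero_le _)
    simp only [Fin.val_last, Fin.val_zero] at h1 h2
    rw [h1, h2, ← smul_comm (segProd a (φ (Fin.last m)) n), ← mul_smul, ← mul_smul,
      ← MulOpposite.op_mul, segProd_mul _ (φ.monotone (Fin.le_last _)) (Fin.is_le _),
      segProd_mul _ (Nat.zero_le _) (φ.monotone (Fin.zero_le _))]
    rfl
  · funext i
    exact (tele _ _ (ψ.monotone i.castSucc_le_succ)).symm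

lemma slotCond_reflection (n : ℕ) (z : Bool) :
    SlotCond k (fun _ : Fin n → A => conjM k A (M := M) z)
      (fun (i : Fin n) a => conjA k z (a (if z then i.rev else i))) := by
  intro j
  have hr : ∀ i i' : Fin n, (if z then i.rev else i) = (if z then i'.rev else i') → i = i' := by
    intro i i'
    cases z <;> simp
  have hj : (if z then (if z then j.rev else j).rev else (if z then j.rev else j)) = j := by
    cases z <;> simp
  refine Or.inr ⟨constAt_const _ _, if z then j.rev else j, ?_, ?_⟩
  · refine LinAt.comp (f := fun a : Fin n → A =>
      a (if z then (if z then j.rev else j).rev else (if z then j.rev else j))) ?_ (conjA k z)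
    rw [hj]
    exact linAt_apply j
  · intro i' hne
    refine ConstAt.comp (constAt_apply fun e => ?_) (conjA k z)
    exact hne (hr _ _ (e.trans hj.symm))

/-- The action of an element of the reflexive group on `M ⊗ A^{⊗ n}`; the generator `r` acts by
`x ⊗ a_1 ⊗ ⋯ ⊗ a_n ↦ star x ⊗ star a_n ⊗ ⋯ ⊗ star a_1`. -/
noncomputable def reflectionMap {n : ℕ} (z : Bool) : TensorMod k A M n →ₗ[k] TensorMod k A M n :=
  slotMap (fun _ : Fin n → A => conjM k A z)
    (fun (i : Fin n) a => conjA k z (a (if z then i.rev else i))) (slotCond_reflection n z)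

lemma reflectionMap_true {n : ℕ} (x : M) (a : Fin n → A) :
    reflectionMap true (pureTensor k x a) = pureTensor k (star x) fun i => star (a i.rev) :=
  slotMap_pureTensor _ _ _ x a

lemma reflectionMap_false {n : ℕ} :
    reflectionMap (k := k) (A := A) (M := M) (n := n) false = LinearMap.id := by
  apply hom_ext_pureTensor
  intro x a
  exact slotMap_pureTensor _ _ _ x a

lemma reflectionMap_comp {n : ℕ} (z w : Bool) :
    reflectionMap (k := k) (A := A) (M := M) (n := n) z ∘ₗ reflectionMap w =
      reflectionMap (xor z w) := by
  cases z <;> cases w <;> simp only [reflectionMap_false, Bool.xor_false, Bool.xor_true,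
    LinearMap.comp_id, LinearMap.id_comp, Bool.not_false, Bool.not_true]
  apply hom_ext_pureTensor
  intro x a
  simp [reflectionMap_true]

lemma lodayMap_reflectionMap {n m : ℕ} (z : Bool) (φ : Fin (m + 1) →o Fin (n + 1)) :
    lodayMap (k := k) (A := A) (M := M) φ ∘ₗ reflectionMap z =
      reflectionMap z ∘ₗ lodayMap (revConj z φ) := by
  cases z
  · simp only [reflectionMap_false, revConj_false, LinearMap.comp_id, LinearMap.id_comp]
  · apply hom_ext_pureTensor
    intro x a
    rw [LinearMap.comp_apply, LinearMap.comp_apply, reflectionMap_true, lodayMap_pureTensor,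
      lodayMap_pureTensor, reflectionMap_true]
    refine congrArg₂ (pureTensor k) ?_ ?_
    · rw [InvolutiveBimodule.star_smul_smul, star_segProd _ (Fin.is_le _) le_rfl,
        star_segProd _ (Nat.zero_le _) (Fin.is_le _), revConj_true, revConj_true]
      simp [Fin.val_rev, Nat.sub_sub_self (Fin.is_le _)]
    · funext i
      rw [star_segProd _ _ (Fin.is_le _), revConj_true, revConj_true]
      · simp [Fin.val_rev, Nat.sub_sub_self (Fin.is_le _), Fin.rev_castSucc, Fin.rev_succ]
      · exact (revConj true φ).monotone i.rev.castSucc_le_succ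

variable (k A M) in
/-- The Loday functor `L(A, M)` on `ΔR^op`: the morphism `(φ, g)`, that is `φ ∘ g`, of `ΔR` acts
by the action of `φ` followed by the action of `g`. -/
noncomputable def lodayFunctor : DeltaRᵒᵖ ⥤ ModuleCat.{u} k where
  obj x := ModuleCat.of k (TensorMod k A M x.unop.n)
  map f := ModuleCat.ofHom
    (reflectionMap (DeltaRHom.refl f.unop) ∘ₗ lodayMap (DeltaRHom.map f.unop))
  map_id x := by
    apply ModuleCat.hom_ext
    change reflectionMap false ∘ₗ lodayMap OrderHom.id = LinearMap.id
    rw [reflectionMap_false, lodayMap_id, LinearMap.id_comp]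
  map_comp f g := by
    apply ModuleCat.hom_ext
    change reflectionMap (xor (DeltaRHom.refl f.unop) (DeltaRHom.refl g.unop)) ∘ₗ
      lodayMap ((DeltaRHom.map f.unop).comp
        (revConj (DeltaRHom.refl f.unop) (DeltaRHom.map g.unop))) =
      (reflectionMap (DeltaRHom.refl g.unop) ∘ₗ lodayMap (DeltaRHom.map g.unop)) ∘ₗ
      (reflectionMap (DeltaRHom.refl f.unop) ∘ₗ lodayMap (DeltaRHom.map f.unop))
    rw [LinearMap.comp_assoc, ← LinearMap.comp_assoc (lodayMap (DeltaRHom.map f.unop)),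
      lodayMap_reflectionMap, lodayMap_comp, Bool.xor_comm, ← reflectionMap_comp]
    rfl

/-! The Loday functor on the generators `δ_i` and `σ_j` of `Δ`. -/

/-- `∂_0(x ⊗ a_1 ⊗ ⋯) = x a_1 ⊗ a_2 ⊗ ⋯`. -/
lemma lodayMap_face_zero {n : ℕ} (x : M) (a : Fin (n + 1) → A) :
    lodayMap (Fin.succAboveOrderEmb (0 : Fin (n + 2))).toOrderHom (pureTensor k x a) =
      pureTensor k (MulOpposite.op (a 0) • x) (Fin.tail a) := by
  rw [lodayMap_pureTensor]
  refine congrArg₂ (pureTensor k) ?_ ?_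
  · have := segProd_succ a 0
    simp at this
    simp [segProd_self, this]
  · funext i
    simpa [Fin.tail] using segProd_succ a i.succ

/-- `∂_i(x ⊗ a_1 ⊗ ⋯ ⊗ a_{n+1}) = x ⊗ ⋯ ⊗ a_i a_{i+1} ⊗ ⋯` for `i = j + 1`, `0 ≤ j < n`. -/
lemma lodayMap_face_middle {n : ℕ} (j : Fin n) (x : M) (a : Fin (n + 1) → A) :
    lodayMap (Fin.succAboveOrderEmb j.succ.castSucc).toOrderHom (pureTensor k x a) =
      pureTensor k x (Fin.contractNth j.castSucc (· * ·) a) := by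
  rw [lodayMap_pureTensor]
  refine congrArg₂ (pureTensor k) ?_ ?_
  · simp [segProd_self]
  · funext i
    have e : ∀ l : Fin (n + 1), ((Fin.succAboveOrderEmb j.succ.castSucc).toOrderHom l : ℕ) =
        if (l : ℕ) ≤ j then (l : ℕ) else l + 1 := by
      intro l
      simp only [OrderEmbedding.toOrderHom_coe, Fin.succAboveOrderEmb_apply, Fin.succAbove,
        Fin.lt_def]
      simp only [Fin.val_castSucc, Fin.val_succ, Nat.lt_succ_iff]
      split_ifs <;> simp
    rw [e, e]
    simp only [Fin.val_castSucc, Fin.val_succ]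
    rcases lt_trichotomy (i : ℕ) j with h | h | h
    · rw [if_pos h.le, if_pos (Nat.succ_le_of_lt h), Fin.contractNth_apply_of_lt _ _ _ _ h]
      exact segProd_succ a i.castSucc
    · rw [if_pos h.le, if_neg (by omega), Fin.contractNth_apply_of_eq _ _ _ _ h,
        ← segProd_succ a i.castSucc, ← segProd_succ a i.succ]
      exact (segProd_mul a (by simp) (by simp)).symm
    · rw [if_neg (by omega), if_neg (by omega), Fin.contractNth_apply_of_gt _ _ _ _ h]
      exact segProd_succ a i.succ

/-- `∂_{n+1}(x ⊗ a_1 ⊗ ⋯ ⊗ a_{n+1}) = a_{n+1} x ⊗ a_1 ⊗ ⋯ ⊗ a_n`. -/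
lemma lodayMap_face_last {n : ℕ} (x : M) (a : Fin (n + 1) → A) :
    lodayMap (Fin.succAboveOrderEmb (Fin.last (n + 1))).toOrderHom (pureTensor k x a) =
      pureTensor k (a (Fin.last n) • x) (Fin.init a) := by
  rw [lodayMap_pureTensor]
  refine congrArg₂ (pureTensor k) ?_ ?_
  · have := segProd_succ a (Fin.last n)
    simp at this
    simp [segProd_self, this]
  · funext i
    simpa [Fin.init] using segProd_succ a i.castSucc

/-- `s_j(x ⊗ a_1 ⊗ ⋯ ⊗ a_n) = x ⊗ a_1 ⊗ ⋯ ⊗ a_j ⊗ 1 ⊗ a_{j+1} ⊗ ⋯ ⊗ a_n` for `0 ≤ j ≤ n`. -/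
lemma lodayMap_degeneracy {n : ℕ} (j : Fin (n + 1)) (x : M) (a : Fin n → A) :
    lodayMap (Fin.predAboveOrderHom j) (pureTensor k x a) =
      pureTensor k x (Fin.insertNth (α := fun _ => A) j 1 a) := by
  rw [lodayMap_pureTensor]
  refine congrArg₂ (pureTensor k) ?_ ?_
  · simp [segProd_self]
  · have e : ∀ l : Fin (n + 2), (Fin.predAboveOrderHom j l : ℕ) =
        if (l : ℕ) ≤ j then (l : ℕ) else l - 1 := by
      intro l
      simp only [Fin.predAboveOrderHom_coe, Fin.predAbove, Fin.lt_def, Fin.val_castSucc]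
      split_ifs <;> first | omega | simp
    funext i
    rw [e, e]
    simp only [Fin.val_castSucc, Fin.val_succ]
    refine Fin.succAboveCases j ?_ (fun i => ?_) i
    · rw [Fin.insertNth_apply_same, if_pos le_rfl, if_neg (by omega), Nat.add_sub_cancel,
        segProd_self]
    · rw [Fin.insertNth_apply_succAbove]
      by_cases h : (i : ℕ) < j
      · rw [Fin.succAbove_of_castSucc_lt _ _ h, if_pos (by simpa using h.le), if_pos (by simpa using h)]
        exact segProd_succ a i
      · rw [Fin.succAbove_of_le_castSucc _ _ (not_lt.1 h), if_neg (by simp; omega),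
          if_neg (by simp; omega)]
        exact segProd_succ a i

variable (k A M) in
/-- The reflexive homology `HR_n(A, M) = Tor_n^{ΔR^op}(k^*, L(A, M))`, where `k^*` is the constant
right module. -/
noncomputable def reflexiveHomology (n : ℕ) : ModuleCat.{u} k :=
  functorTor n ((Functor.const (DeltaRᵒᵖ)ᵒᵖ).obj (ModuleCat.of k k)) (lodayFunctor k A M)

end InvolutiveAlgebras

end ReflexiveHomology

/-! The Loday functor is the restriction of `functorR` along a faithful functor `dualFunctor` from
the opposite of `DeltaR` to `IGammaAs` (`lodayIso`). The theorem is then a change-of-category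
statement for Tor along `i = dualFunctor`.

For any `i : C ⥤ D`, tensoring `k^*` with `i ⋙ F` over `C` amounts to tensoring the left Kan
extension of `k^*` with `F` over `D`, and that extension has value `k[π₀(d ↓ i)]` at `d`. Suppose
every comma category `d ↓ i` is a disjoint union of categories with initial objects
(`InitialFactorization`). Then `D(d, i -)` is a coproduct of representables of `C`, so restriction
along `i` preserves projectives; it is also exact. Hence it carries projective resolutions to
projective resolutions, and the isomorphism `tensorIso`, applied in each degree, identifies the
derived functors (`nonempty_functorTor_iso`).

The hypothesis holds for `dualFunctor` because of the unique decomposition of a morphism into an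
element of `H⁺` followed by a dihedral morphism (`existsUnique_hPlus`). If the morphism is based, so
is its dihedral factor, as `H⁺` fixes `0`. It remains to see that the based dihedral morphisms are
exactly the images of morphisms of `DeltaR`, each arising once (`exists_eq_dual_comp_reflHyp`,
`dual_comp_reflHyp_injective`). The components of `d ↓ i` are therefore indexed by `H⁺`, and the Kan
extension is literally `functorBPrime`.

The duality is best seen on the integers. An order-preserving `φ : [m] → [n]` extends to a monotone
`Φ : ℤ → ℤ` with `Φ(x + m + 1) = Φ(x) + n + 1`. The intervals `(Φ(i-1), Φ(i)]`, read modulo `n + 1`,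
are the ordered fibres of a based map `[n] → [m]`. The reflection of `DeltaR` becomes `i ↦ -i` with
all labels `t`. Conversely, the fibres of a dihedral map, concatenated, form one full period up to
reversal; the cut points between consecutive fibres recover `φ`. -/

namespace ReflexiveHomology

/-! ### Elements of the tensor product over a category -/

section TensorOver

variable {k : Type u} [CommRing k] {C : Type} [SmallCategory C]

/-- The canonical bilinear map `G(c) × F(c) → G ⊗_C F`. -/
noncomputable def tensorMk (G : Cᵒᵖ ⥤ ModuleCat.{u} k) (F : C ⥤ ModuleCat.{u} k) (c : C) :
    G.obj (op c) →ₗ[k] F.obj c →ₗ[k] (tensorOver G).obj F :=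
  (TensorProduct.mk k (G.obj (op c)) (F.obj c)).compr₂ (coend.ι (externalTensor G F) c).hom

/-- The coend relation on elements; every transfer between the two tensor factors below is an
instance of it. -/
lemma tensorMk_map (G : Cᵒᵖ ⥤ ModuleCat.{u} k) (F : C ⥤ ModuleCat.{u} k) {c d : C} (f : c ⟶ d)
    (x : G.obj (op d)) (y : F.obj c) :
    tensorMk G F c ((G.map f.op).hom x) y = tensorMk G F d x ((F.map f).hom y) :=
  congrArg (fun φ => φ.hom (x ⊗ₜ[k] y)) (coend.condition (externalTensor G F) f)

lemma tensorOver_hom_ext {G : Cᵒᵖ ⥤ ModuleCat.{u} k} {F : C ⥤ ModuleCat.{u} k}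
    {N : ModuleCat.{u} k} {f g : (tensorOver G).obj F ⟶ N}
    (h : ∀ c x y, f.hom (tensorMk G F c x y) = g.hom (tensorMk G F c x y)) : f = g := by
  apply coend.hom_ext
  intro c
  apply ModuleCat.hom_ext
  apply TensorProduct.ext'
  exact h c

/-- Maps out of `G ⊗_C F` are given by balanced families of bilinear maps. -/
noncomputable def tensorDesc {G : Cᵒᵖ ⥤ ModuleCat.{u} k} {F : C ⥤ ModuleCat.{u} k}
    {N : ModuleCat.{u} k} (β : ∀ c, G.obj (op c) →ₗ[k] F.obj c →ₗ[k] N)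
    (hβ : ∀ (c d : C) (f : c ⟶ d) (x : G.obj (op d)) (y : F.obj c),
      β c ((G.map f.op).hom x) y = β d x ((F.map f).hom y)) :
    (tensorOver G).obj F ⟶ N :=
  coend.desc (F := externalTensor G F) (fun c => ModuleCat.ofHom (TensorProduct.lift (β c))) (by
    intro c d f
    apply ModuleCat.hom_ext
    apply TensorProduct.ext'
    exact hβ c d f)

lemma tensorDesc_mk {G : Cᵒᵖ ⥤ ModuleCat.{u} k} {F : C ⥤ ModuleCat.{u} k}
    {N : ModuleCat.{u} k} (β : ∀ c, G.obj (op c) →ₗ[k] F.obj c →ₗ[k] N)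
    (hβ : ∀ (c d : C) (f : c ⟶ d) (x : G.obj (op d)) (y : F.obj c),
      β c ((G.map f.op).hom x) y = β d x ((F.map f).hom y)) (c : C) (x : G.obj (op c))
    (y : F.obj c) : (tensorDesc β hβ).hom (tensorMk G F c x y) = β c x y :=
  congrArg (fun φ : ((externalTensor G F).obj (op c)).obj c ⟶ N => φ.hom (x ⊗ₜ[k] y))
    (coend.ι_desc (F := externalTensor G F)
      (fun c => ModuleCat.ofHom (TensorProduct.lift (β c))) _ c)

lemma tensorOver_map_mk (G : Cᵒᵖ ⥤ ModuleCat.{u} k) {F F' : C ⥤ ModuleCat.{u} k} (α : F ⟶ F')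
    (c : C) (x : G.obj (op c)) (y : F.obj c) :
    ((tensorOver G).map α).hom (tensorMk G F c x y) = tensorMk G F' c x ((α.app c).hom y) :=
  congrArg (fun φ => φ.hom (x ⊗ₜ[k] y)) (coend.ι_map (F := externalTensor G F)
    (F' := externalTensor G F') _ c)

end TensorOver

/-! ### Change of categories when the comma categories have componentwise initial objects -/

/-- Every morphism `d ⟶ i(c)` factors uniquely as a member of a given family of morphisms
`d ⟶ i(b)` followed by the image of a morphism `b ⟶ c`: each comma category `d ↓ i` is a
disjoint union of categories with initial objects. -/
structure InitialFactorization {C D : Type} [SmallCategory C] [SmallCategory D] (i : C ⥤ D) where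
  /-- the components of the comma category -/
  index : D → Type
  /-- the target of the initial object of a component -/
  obj {d : D} : index d → C
  arrow {d : D} (h : index d) : d ⟶ i.obj (obj h)
  /-- the component of a morphism -/
  part {d : D} {c : C} : (d ⟶ i.obj c) → index d
  lift {d : D} {c : C} (g : d ⟶ i.obj c) : obj (part g) ⟶ c
  fac {d : D} {c : C} (g : d ⟶ i.obj c) : arrow (part g) ≫ i.map (lift g) = g
  part_arrow_comp {d : D} {c : C} (h : index d) (a : obj h ⟶ c) : part (arrow h ≫ i.map a) = h
  cancel {d : D} {c : C} (h : index d) {a a' : obj h ⟶ c}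
    (e : arrow h ≫ i.map a = arrow h ≫ i.map a') : a = a'

namespace InitialFactorization

variable {k : Type u} [CommRing k] {C D : Type} [SmallCategory C] [SmallCategory D] {i : C ⥤ D}
  (Φ : InitialFactorization i)

/-- `a` is a morphism of the comma category from `g` to `g ≫ i.map a`, so both lie in one component.
-/
lemma part_comp {d : D} {c c' : C} (g : d ⟶ i.obj c) (a : c ⟶ c') :
    Φ.part (g ≫ i.map a) = Φ.part g := by
  conv_lhs => rw [← Φ.fac g, Category.assoc, ← i.map_comp]
  exact Φ.part_arrow_comp _ _

lemma part_arrow {d : D} (h : Φ.index d) : Φ.part (Φ.arrow h) = h := by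
  simpa using Φ.part_arrow_comp h (𝟙 _)

lemma part_comp_arrow_part_id {d : D} {c : C} (g : d ⟶ i.obj c) :
    Φ.part (g ≫ Φ.arrow (Φ.part (𝟙 (i.obj c)))) = Φ.part g := by
  rw [← Φ.part_comp _ (Φ.lift (𝟙 (i.obj c))), Category.assoc, Φ.fac, Category.comp_id]

/-- `lift g` links the two composites inside the comma category. This is what makes
`componentModule` functorial. -/
lemma part_comp_arrow_part {d d' : D} {c : C} (f : d ⟶ d') (g : d' ⟶ i.obj c) :
    Φ.part (f ≫ Φ.arrow (Φ.part g)) = Φ.part (f ≫ g) := by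
  rw [← Φ.part_comp _ (Φ.lift g), Category.assoc, Φ.fac]

variable (k) in
/-- The right module `d ↦ k[π₀(d ↓ i)]`, the left Kan extension of the constant right module. -/
noncomputable def componentModule : Dᵒᵖ ⥤ ModuleCat.{u} k where
  obj d := ModuleCat.of k (Φ.index d.unop →₀ k)
  map f := ModuleCat.ofHom (Finsupp.lmapDomain k k fun h => Φ.part (f.unop ≫ Φ.arrow h))
  map_id d := by
    simp only [unop_id, Category.id_comp, part_arrow]
    exact congrArg ModuleCat.ofHom (Finsupp.lmapDomain_id k k)
  map_comp f g := by
    rw [← ModuleCat.ofHom_comp, ← Finsupp.lmapDomain_comp]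
    congr 2
    funext h
    simp only [Function.comp_apply, part_comp_arrow_part, unop_comp, Category.assoc]

/-- The basis elements of `componentModule`. -/
noncomputable def gen {d : D} (h : Φ.index d) : (Φ.componentModule k).obj (op d) :=
  (Finsupp.single h 1 : Φ.index d →₀ k)

lemma map_gen {d d' : D} (f : d ⟶ d') (h : Φ.index d') :
    ((Φ.componentModule k).map f.op).hom (Φ.gen h) = Φ.gen (Φ.part (f ≫ Φ.arrow h)) :=
  Finsupp.mapDomain_single

lemma linearMap_ext {d : D} {N : Type u} [AddCommGroup N] [Module k N]
    {f g : (Φ.componentModule k).obj (op d) →ₗ[k] N} (h : ∀ x, f (Φ.gen x) = g (Φ.gen x)) :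
    f = g := by
  apply Finsupp.lhom_ext'
  intro x
  apply LinearMap.ext_ring
  exact h x

/-- The constant right module. -/
noncomputable abbrev constModule (k : Type u) [CommRing k] (C : Type) [SmallCategory C] :
    Cᵒᵖ ⥤ ModuleCat.{u} k :=
  (Functor.const Cᵒᵖ).obj (ModuleCat.of k k)

/-- The unit spans the value `k` of the constant module, so tensors with left factor `1` generate.
-/
lemma constModule_hom_ext {F : C ⥤ ModuleCat.{u} k} {N : ModuleCat.{u} k}
    {f g : (tensorOver (constModule k C)).obj F ⟶ N}
    (h : ∀ c y, f.hom (tensorMk (constModule k C) F c (1 : k) y) =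
      g.hom (tensorMk (constModule k C) F c (1 : k) y)) : f = g := by
  apply tensorOver_hom_ext
  intro c x y
  have key : ∀ φ : (tensorOver (constModule k C)).obj F ⟶ N,
      φ.hom (tensorMk (constModule k C) F c x y) =
      (show k from x) • φ.hom (tensorMk (constModule k C) F c (1 : k) y) := by
    intro φ
    have hx : tensorMk (constModule k C) F c x =
        (show k from x) • tensorMk (constModule k C) F c (1 : k) := by
      rw [← map_smul]
      exact congrArg _ (mul_one (show k from x)).symm
    rw [hx, LinearMap.smul_apply, map_smul]
  rw [key, key, h]

lemma componentModule_hom_ext {F : D ⥤ ModuleCat.{u} k} {N : ModuleCat.{u} k}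
    {f g : (tensorOver (Φ.componentModule k)).obj F ⟶ N}
    (h : ∀ d x y, f.hom (tensorMk (Φ.componentModule k) F d (Φ.gen x) y) =
      g.hom (tensorMk (Φ.componentModule k) F d (Φ.gen x) y)) : f = g := by
  apply tensorOver_hom_ext
  intro d x y
  have : f.hom ∘ₗ (tensorMk (Φ.componentModule k) F d).flip y =
      g.hom ∘ₗ (tensorMk (Φ.componentModule k) F d).flip y :=
    Φ.linearMap_ext fun x => h d x y
  exact LinearMap.congr_fun this x

variable (k) in
/-- The map `k^* ⊗_C i^*F → k[π₀(- ↓ i)] ⊗_D F`. -/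
noncomputable def toComponent (F : D ⥤ ModuleCat.{u} k) :
    (tensorOver (constModule k C)).obj (i ⋙ F) ⟶ (tensorOver (Φ.componentModule k)).obj F :=
  -- The identity of `i(c)` is an object of `i(c) ↓ i`; its component is the image of `1` under the
  -- unit of the Kan extension.
  tensorDesc (fun c => LinearMap.toSpanSingleton k _
      (tensorMk (Φ.componentModule k) F (i.obj c) (Φ.gen (Φ.part (𝟙 (i.obj c)))))) (by
    intro c d f x y
    change x • tensorMk (Φ.componentModule k) F (i.obj c) _ y =
      x • tensorMk (Φ.componentModule k) F (i.obj d) _ ((F.map (i.map f)).hom y)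
    rw [← tensorMk_map, map_gen, part_comp_arrow_part, Category.comp_id,
      ← Φ.part_comp (𝟙 (i.obj c)) f, Category.id_comp])

lemma toComponent_mk (F : D ⥤ ModuleCat.{u} k) (c : C) (y : F.obj (i.obj c)) :
    (Φ.toComponent k F).hom (tensorMk (constModule k C) (i ⋙ F) c (1 : k) y) =
      tensorMk (Φ.componentModule k) F (i.obj c) (Φ.gen (Φ.part (𝟙 (i.obj c)))) y := by
  refine (tensorDesc_mk _ _ _ _ _).trans ?_
  change (1 : k) • tensorMk (Φ.componentModule k) F (i.obj c) _ y = _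
  rw [one_smul]

/-- The bilinear map `(h, y) ↦ 1 ⊗ F(h)(y)`. -/
noncomputable def ofComponentBilin (F : D ⥤ ModuleCat.{u} k) (d : D) :
    (Φ.componentModule k).obj (op d) →ₗ[k] F.obj d →ₗ[k]
      (tensorOver (constModule k C)).obj (i ⋙ F) :=
  Finsupp.lsum k fun h : Φ.index d => LinearMap.toSpanSingleton k
    (F.obj d →ₗ[k] (tensorOver (constModule k C)).obj (i ⋙ F))
    (tensorMk (constModule k C) (i ⋙ F) (Φ.obj h) (1 : k) ∘ₗ (F.map (Φ.arrow h)).hom)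

lemma ofComponentBilin_gen (F : D ⥤ ModuleCat.{u} k) {d : D} (h : Φ.index d) (y : F.obj d) :
    Φ.ofComponentBilin F d (Φ.gen h) y =
      tensorMk (constModule k C) (i ⋙ F) (Φ.obj h) (1 : k) ((F.map (Φ.arrow h)).hom y) := by
  have : Φ.ofComponentBilin F d (Φ.gen h) =
      tensorMk (constModule k C) (i ⋙ F) (Φ.obj h) (1 : k) ∘ₗ (F.map (Φ.arrow h)).hom := by
    refine (Finsupp.sum_single_index (by simp)).trans ?_
    simp
  rw [this]
  rfl

lemma tensorMk_const_map (F : C ⥤ ModuleCat.{u} k) {c d : C} (f : c ⟶ d) (y : F.obj c) :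
    tensorMk (constModule k C) F d (1 : k) ((F.map f).hom y) =
      tensorMk (constModule k C) F c (1 : k) y :=
  (tensorMk_map (constModule k C) F f (1 : k) y).symm

variable (k) in
/-- The map `k[π₀(- ↓ i)] ⊗_D F → k^* ⊗_C i^*F`. -/
noncomputable def ofComponent (F : D ⥤ ModuleCat.{u} k) :
    (tensorOver (Φ.componentModule k)).obj F ⟶ (tensorOver (constModule k C)).obj (i ⋙ F) :=
  tensorDesc (Φ.ofComponentBilin F) (by
    intro d d' f x y
    have : (Φ.ofComponentBilin F d).flip y ∘ₗ ((Φ.componentModule k).map f.op).hom =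
        (Φ.ofComponentBilin F d').flip ((F.map f).hom y) := by
      apply Φ.linearMap_ext
      intro h
      change Φ.ofComponentBilin F d (((Φ.componentModule k).map f.op).hom (Φ.gen h)) y =
        Φ.ofComponentBilin F d' (Φ.gen h) ((F.map f).hom y)
      -- `f ≫ arrow h` is the initial arrow of its component followed by `i(lift)`, and tensoring
      -- with the constant module makes `lift` act trivially.
      rw [map_gen, ofComponentBilin_gen, ofComponentBilin_gen,
        ← tensorMk_const_map (i ⋙ F) (Φ.lift (f ≫ Φ.arrow h))]
      refine congrArg _ ?_
      simp only [Functor.comp_map, ← LinearMap.comp_apply, ← ModuleCat.hom_comp, ← F.map_comp,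
        Φ.fac]
    exact LinearMap.congr_fun this x)

lemma ofComponent_mk (F : D ⥤ ModuleCat.{u} k) {d : D} (h : Φ.index d) (y : F.obj d) :
    (Φ.ofComponent k F).hom (tensorMk (Φ.componentModule k) F d (Φ.gen h) y) =
      tensorMk (constModule k C) (i ⋙ F) (Φ.obj h) (1 : k) ((F.map (Φ.arrow h)).hom y) :=
  (tensorDesc_mk _ _ _ _ _).trans (Φ.ofComponentBilin_gen F h y)

variable (k) in
/-- The isomorphism `k^* ⊗_C i^*F ≅ k[π₀(- ↓ i)] ⊗_D F`, natural in `F`. -/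
noncomputable def tensorIso :
    (Functor.whiskeringLeft C D (ModuleCat.{u} k)).obj i ⋙ tensorOver (constModule k C) ≅
      tensorOver (Φ.componentModule k) :=
  NatIso.ofComponents
    (fun F =>
      { hom := Φ.toComponent k F
        inv := Φ.ofComponent k F
        hom_inv_id := by
          apply constModule_hom_ext (F := i ⋙ F)
          intro c y
          change (Φ.ofComponent k F).hom ((Φ.toComponent k F).hom _) = _
          rw [toComponent_mk, ofComponent_mk,
            ← tensorMk_const_map (i ⋙ F) (Φ.lift (𝟙 (i.obj c)))]
          refine congrArg _ ?_
          simp only [Functor.comp_map, ← LinearMap.comp_apply, ← ModuleCat.hom_comp,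
            ← F.map_comp, Φ.fac, F.map_id]
          rfl
        inv_hom_id := by
          apply Φ.componentModule_hom_ext
          intro d h y
          change (Φ.toComponent k F).hom ((Φ.ofComponent k F).hom _) = _
          -- Moving `F(arrow h)` across the tensor precomposes the index with `arrow h`, which
          -- returns the component `h` itself.
          rw [ofComponent_mk, toComponent_mk, ← tensorMk_map, map_gen,
            part_comp_arrow_part_id, part_arrow]
          rfl })
    (by
      intro F F' α
      apply constModule_hom_ext (F := i ⋙ F)
      intro c y
      change (Φ.toComponent k F').hom (((tensorOver (constModule k C)).map
        (Functor.whiskerLeft i α)).hom _) = ((tensorOver (Φ.componentModule k)).map α).hom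
          ((Φ.toComponent k F).hom _)
      rw [tensorOver_map_mk, toComponent_mk, toComponent_mk, tensorOver_map_mk]
      rfl)

/-! ### Restriction preserves projectives, and the comparison of Tor -/

/-- Every generator is pushed forward, along a morphism of `C`, from the generator at the initial
arrow of its component. Hence the generators at the arrows `Φ.arrow h` already generate the
restriction as a functor on `C`. -/
lemma freeCoverGen_map_fac (F : D ⥤ ModuleCat.{u} k) {d : D} {c : C} (x : F.obj d)
    (g : d ⟶ i.obj c) :
    ((freeCover F).map (i.map (Φ.lift g))).hom (freeCoverGen F x (Φ.arrow (Φ.part g))) =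
      freeCoverGen F x g := by
  rw [freeCover_map_gen, Φ.fac]

include Φ in
/-- The restriction of `freeCover F` along `i` is free on the generators
`freeCoverGen F x (Φ.arrow h)`. -/
lemma projective_comp_freeCover (F : D ⥤ ModuleCat.{u} k) : Projective (i ⋙ freeCover F) where
  factors {X Y} f e he := by
    have hs : ∀ c, Function.Surjective (e.app c).hom := fun c =>
      (ModuleCat.epi_iff_surjective _).1 ((NatTrans.epi_iff_epi_app e).1 he c)
    -- Preimages are chosen only at initial arrows; naturality dictates the values `t` at all other
    -- generators.
    choose s hs using fun (d : D) (x : F.obj d) (h : Φ.index d) =>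
      hs (Φ.obj h) ((f.app (Φ.obj h)).hom (freeCoverGen F x (Φ.arrow h)))
    let t : ∀ c, ∀ y : (Σ d : D, F.obj d × (d ⟶ i.obj c)), X.obj c := fun c y =>
      (X.map (Φ.lift y.2.2)).hom (s y.1 y.2.1 (Φ.part y.2.2))
    have ht : ∀ {c c' : C} (a : c ⟶ c') (d : D) (x : F.obj d) (g : d ⟶ i.obj c),
        (X.map a).hom (t c ⟨d, x, g⟩) = t c' ⟨d, x, g ≫ i.map a⟩ := by
      intro c c' a d x g
      -- The lifts of `g` and of `g ≫ i.map a` start at `obj` of two components that are equal only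
      -- propositionally. Generalising the component to `h` allows substitution, after which
      -- `cancel` identifies the two morphisms out of the initial object.
      have key : ∀ (h : Φ.index d) (hh : h = Φ.part g) (b : Φ.obj h ⟶ c'),
          Φ.arrow h ≫ i.map b = g ≫ i.map a →
          (X.map b).hom (s d x h) = (X.map a).hom ((X.map (Φ.lift g)).hom (s d x (Φ.part g))) := by
        rintro h rfl b hb
        rw [← LinearMap.comp_apply, ← ModuleCat.hom_comp, ← X.map_comp]
        congr 3
        apply Φ.cancel
        rw [hb, i.map_comp, ← Category.assoc, Φ.fac]
      exact (key _ (Φ.part_comp g a) _ (Φ.fac _)).symm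
    let T : ∀ c, (i ⋙ freeCover F).obj c ⟶ X.obj c := fun c =>
      ModuleCat.ofHom (Finsupp.lsum k
        (fun y : (Σ d : D, F.obj d × (d ⟶ i.obj c)) => LinearMap.toSpanSingleton k _ (t c y)))
    have hT : ∀ c (d : D) (x : F.obj d) (g : d ⟶ i.obj c),
        (T c).hom (freeCoverGen F x g) = t c ⟨d, x, g⟩ := by
      intro c d x g
      refine (Finsupp.sum_single_index (by simp)).trans ?_
      simp
    refine ⟨{ app := T, naturality := ?_ }, ?_⟩
    · intro c c' a
      apply freeCover_hom_ext
      intro d x g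
      change (T c').hom (((freeCover F).map (i.map a)).hom _) = (X.map a).hom ((T c).hom _)
      rw [freeCover_map_gen, hT, hT, ht]
    · apply NatTrans.ext
      funext c
      apply freeCover_hom_ext
      intro d x g
      change (e.app c).hom ((T c).hom _) = _
      rw [hT]
      have h1 := congrArg (fun φ => φ.hom (s d x (Φ.part g))) (e.naturality (Φ.lift g))
      have h2 := congrArg (fun φ => φ.hom (freeCoverGen F x (Φ.arrow (Φ.part g))))
        (f.naturality (Φ.lift g))
      change (e.app c).hom ((X.map (Φ.lift g)).hom _) = (Y.map (Φ.lift g)).hom _ at h1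
      change (f.app c).hom (((freeCover F).map (i.map (Φ.lift g))).hom _) =
        (Y.map (Φ.lift g)).hom _ at h2
      rw [← freeCoverGen_map_fac Φ F x g, h2]
      exact h1.trans (congrArg _ (hs _ _ _))

-- A projective functor is a retract of its free cover, and retracts survive restriction, so
-- `projective_comp_freeCover` suffices.
include Φ in
lemma preservesProjectiveObjects :
    ((Functor.whiskeringLeft C D (ModuleCat.{u} k)).obj i).PreservesProjectiveObjects where
  projective_obj {F} hF := by
    have hepi : Epi (freeCoverDesc F F (fun _ x => x)) := by
      rw [NatTrans.epi_iff_epi_app]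
      intro c
      rw [ModuleCat.epi_iff_surjective]
      intro x
      refine ⟨freeCoverGen F x (𝟙 c), ?_⟩
      refine (freeCoverDescApp_gen F F _ x (𝟙 c)).trans ?_
      simp
    let r : Retract F (freeCover F) :=
      { i := Projective.factorThru (𝟙 F) (freeCoverDesc F F (fun _ x => x))
        r := freeCoverDesc F F (fun _ x => x)
        retract := Projective.factorThru_comp _ _ }
    have : Projective (((Functor.whiskeringLeft C D (ModuleCat.{u} k)).obj i).obj (freeCover F)) :=
      Φ.projective_comp_freeCover F
    exact (r.map ((Functor.whiskeringLeft C D (ModuleCat.{u} k)).obj i)).projective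

include Φ in
/-- Restriction along `i` identifies the derived functors of `k^* ⊗_C -` and
`k[π₀(- ↓ i)] ⊗_D -`. -/
theorem nonempty_functorTor_iso (F : D ⥤ ModuleCat.{u} k) (n : ℕ) :
    Nonempty (functorTor n (constModule k C) (i ⋙ F) ≅
      functorTor n (Φ.componentModule k) F) := by
  let W := (Functor.whiskeringLeft C D (ModuleCat.{u} k)).obj i
  have : W.PreservesProjectiveObjects := Φ.preservesProjectiveObjects
  have : W.Additive := { map_add := rfl }
  -- Limits and colimits of functors are computed pointwise, so restriction is exact.
  have : PreservesFiniteLimits W := inferInstance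
  have : PreservesFiniteColimits W := inferInstance
  have : W.PreservesHomology := inferInstance
  let P := projectiveResolution F
  let e1 := (W.mapProjectiveResolution P).isoLeftDerivedObj (tensorOver (constModule k C)) n
  let e2 := P.isoLeftDerivedObj (tensorOver (Φ.componentModule k)) n
  -- The restricted resolution computes the left-hand Tor; naturality of `tensorIso` makes its
  -- components commute with the differentials.
  let e : ((tensorOver (constModule k C)).mapHomologicalComplex _).obj
      ((W.mapHomologicalComplex _).obj P.complex) ≅
      ((tensorOver (Φ.componentModule k)).mapHomologicalComplex _).obj P.complex :=
    HomologicalComplex.Hom.isoOfComponents (fun j => (Φ.tensorIso k).app (P.complex.X j))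
      (fun j j' _ => ((Φ.tensorIso k).hom.naturality (P.complex.d j j')).symm)
  exact ⟨e1 ≪≫ (HomologicalComplex.homologyFunctor _ _ n).mapIso e ≪≫ e2.symm⟩

end InitialFactorization

/-! ### Intervals of integers read modulo `n + 1` -/

section CyclicLists

/-- The residue of an integer modulo `n + 1`, as an element of `[n]`. -/
def cyc (n : ℕ) (x : ℤ) : Fin (n + 1) :=
  ⟨(x % (n + 1 : ℕ)).toNat, by
    have h1 := Int.emod_nonneg x (b := (n + 1 : ℕ)) (by omega)
    have h2 := Int.emod_lt_of_pos x (b := (n + 1 : ℕ)) (by omega)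
    omega⟩

lemma cyc_val (n : ℕ) (x : ℤ) : ((cyc n x : ℕ) : ℤ) = x % (n + 1 : ℕ) :=
  Int.toNat_of_nonneg (Int.emod_nonneg x (by omega))

lemma cyc_eq_iff {n : ℕ} {x y : ℤ} : cyc n x = cyc n y ↔ x % (n + 1 : ℕ) = y % (n + 1 : ℕ) := by
  rw [← cyc_val, ← cyc_val, Fin.ext_iff]
  omega

lemma cyc_coe {n : ℕ} (i : Fin (n + 1)) : cyc n (i : ℕ) = i := by
  have h := cyc_val n (i : ℕ)
  rw [Int.emod_eq_of_lt (by omega) (by omega)] at h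
  exact Fin.ext (by omega)

lemma cyc_add (n : ℕ) (x : ℤ) : cyc n (x + (n + 1 : ℕ)) = cyc n x := by
  rw [cyc_eq_iff, Int.add_emod_right]

/-- The list `s + 1, …, t` of residues modulo `n + 1`, with trivial labels. -/
def seg (n : ℕ) (s t : ℤ) : List (Fin (n + 1) × Bool) :=
  (List.range (t - s).toNat).map fun i : ℕ => (cyc n (s + 1 + i), false)

lemma seg_self (n : ℕ) (s : ℤ) : seg n s s = [] := by
  simp [seg]

lemma seg_one (n : ℕ) (s : ℤ) : seg n s (s + 1) = [(cyc n (s + 1), false)] := by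
  simp [seg]

lemma length_seg (n : ℕ) (s t : ℤ) : (seg n s t).length = (t - s).toNat := by
  simp [seg]

lemma getElem_seg {n : ℕ} {s t : ℤ} {i : ℕ} (h : i < (seg n s t).length) :
    (seg n s t)[i] = (cyc n (s + 1 + i), false) := by
  simp [seg]

/-- The intervals are half-open, `(s, t]`, so consecutive ones meet without overlap. Both
inequalities matter: `seg` is empty when its endpoints are in the wrong order. -/
lemma seg_append (n : ℕ) {s t w : ℤ} (h : s ≤ t) (h' : t ≤ w) :
    seg n s t ++ seg n t w = seg n s w := by
  apply List.ext_getElem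
  · simp only [List.length_append, length_seg]
    omega
  · intro i h1 h2
    rw [List.getElem_append]
    split_ifs with hi
    · rw [getElem_seg, getElem_seg]
    · rw [getElem_seg, getElem_seg]
      rw [length_seg] at hi ⊢
      congr 2
      omega

lemma seg_add (n : ℕ) (s t : ℤ) : seg n (s + (n + 1 : ℕ)) (t + (n + 1 : ℕ)) = seg n s t := by
  apply List.ext_getElem
  · simp only [length_seg]
    omega
  · intro i h1 h2
    rw [getElem_seg, getElem_seg, ← cyc_add n (s + 1 + i)]
    congr 2
    ring

lemma seg_period (n : ℕ) (q s t : ℤ) :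
    seg n (s + (n + 1 : ℕ) * q) (t + (n + 1 : ℕ) * q) = seg n s t := by
  induction q using Int.induction_on with
  | zero => simp
  | succ q ih => rw [mul_add, mul_one, ← add_assoc, ← add_assoc, seg_add, ih]
  | pred q ih => rw [← ih, ← seg_add n (s + _)]; congr 1 <;> ring

lemma mem_seg {n : ℕ} {s t : ℤ} {p : Fin (n + 1) × Bool} :
    p ∈ seg n s t ↔ ∃ x, s < x ∧ x ≤ t ∧ p = (cyc n x, false) := by
  simp only [seg, List.mem_map, List.mem_range]
  constructor
  · rintro ⟨i, hi, rfl⟩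
    exact ⟨s + 1 + i, by omega, by omega, rfl⟩
  · rintro ⟨x, h1, h2, rfl⟩
    exact ⟨(x - (s + 1)).toNat, by omega, by congr 2; omega⟩

lemma seg_eq_std (n : ℕ) : seg n (-1) n = std n := by
  apply List.ext_getElem
  · simp only [length_seg, std, List.length_map, List.length_finRange]
    omega
  · intro i h1 h2
    rw [getElem_seg]
    simp only [std, List.getElem_map, List.getElem_finRange]
    congr 1
    rw [← cyc_coe (Fin.cast _ _)]
    congr 1
    simp

/-- A full period is the standard list up to rotation. -/
lemma isRotated_seg (n : ℕ) (s : ℤ) : (seg n s (s + (n + 1 : ℕ))).IsRotated (std n) := by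
  have step : ∀ s, (seg n (s + 1) (s + 1 + (n + 1 : ℕ))).IsRotated
      (seg n s (s + (n + 1 : ℕ))) := by
    intro s
    -- Advancing the window by one removes the entry in `(s, s + 1]` from the front and adds the
    -- same residue at the back.
    rw [← seg_append n (show s ≤ s + 1 by omega) (show s + 1 ≤ s + (n + 1 : ℕ) by omega),
      ← seg_append n (show s + 1 ≤ s + (n + 1 : ℕ) by omega)
        (show s + (n + 1 : ℕ) ≤ s + 1 + (n + 1 : ℕ) by omega), seg_add]
    exact List.isRotated_append
  have base : (seg n (-1) (-1 + (n + 1 : ℕ))).IsRotated (std n) := by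
    rw [← seg_eq_std]
    have : (-1 + (n + 1 : ℕ) : ℤ) = n := by push_cast; ring
    rw [this]
  induction s using Int.induction_on with
  | zero => exact (step (-1)).trans base
  | succ s ih => exact (step s).trans ih
  | pred s ih =>
    have := step (-s - 1)
    rw [sub_add_cancel] at this
    exact this.symm.trans ih

end CyclicLists

/-! ### Periodic extension of order-preserving maps to the integers -/

section PeriodicExtension

/-- The extension of `φ : [m] → [n]` to a map of integers with
`Φ(x + m + 1) = Φ(x) + n + 1`. -/
def periodic {n m : ℕ} (φ : Fin (m + 1) →o Fin (n + 1)) (x : ℤ) : ℤ :=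
  (φ (cyc m x) : ℕ) + (n + 1 : ℕ) * (x / (m + 1 : ℕ))

variable {n m p : ℕ} (φ : Fin (m + 1) →o Fin (n + 1))

lemma periodic_add (x : ℤ) : periodic φ (x + (m + 1 : ℕ)) = periodic φ x + (n + 1 : ℕ) := by
  rw [periodic, periodic, cyc_add, Int.add_ediv_of_dvd_right (dvd_refl _),
    Int.ediv_self (by omega)]
  ring

lemma periodic_period (x q : ℤ) :
    periodic φ (x + (m + 1 : ℕ) * q) = periodic φ x + (n + 1 : ℕ) * q := by
  induction q using Int.induction_on with
  | zero => simp
  | succ q ih =>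
    rw [show x + (m + 1 : ℕ) * ((q : ℤ) + 1) = x + (m + 1 : ℕ) * q + (m + 1 : ℕ) by ring,
      periodic_add, ih]
    ring
  | pred q ih =>
    have := periodic_add φ (x + (m + 1 : ℕ) * (-q - 1))
    rw [show x + (m + 1 : ℕ) * (-(q : ℤ) - 1) + (m + 1 : ℕ) = x + (m + 1 : ℕ) * (-q) by ring,
      ih] at this
    linarith

lemma periodic_coe (i : Fin (m + 1)) : periodic φ (i : ℕ) = (φ i : ℕ) := by
  rw [periodic, cyc_coe, Int.ediv_eq_zero_of_lt (by omega) (by omega)]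
  simp

lemma periodic_zero : periodic φ 0 = (φ 0 : ℕ) := periodic_coe φ 0

lemma periodic_last : periodic φ m = (φ (Fin.last m) : ℕ) := periodic_coe φ (Fin.last m)

lemma periodic_neg_one : periodic φ (-1) = (φ (Fin.last m) : ℕ) - (n + 1 : ℕ) := by
  have h := periodic_add φ (-1)
  rw [show (-1 + (m + 1 : ℕ) : ℤ) = m by push_cast; ring, periodic_last] at h
  linarith

/-- Within one block of `m + 1` integers this is monotonicity of `φ`. Passing to a later block adds
at least `n + 1`, which exceeds the whole variation of `φ`. -/
lemma periodic_mono : Monotone (periodic φ) := by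
  intro x y h
  have hd : x / (m + 1 : ℕ) ≤ y / (m + 1 : ℕ) := Int.ediv_le_ediv (by omega) h
  rcases hd.eq_or_lt with e | hlt
  · have h1 := cyc_val m x
    have h2 := cyc_val m y
    have h3 := Int.mul_ediv_add_emod x (m + 1 : ℕ)
    have h4 := Int.mul_ediv_add_emod y (m + 1 : ℕ)
    have hle : cyc m x ≤ cyc m y := by
      rw [Fin.le_def]
      rw [e] at h3
      omega
    have := Fin.le_def.1 (φ.monotone hle)
    rw [periodic, periodic, e]
    omega
  · rw [periodic, periodic]
    have h1 := (φ (cyc m x)).2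
    have h2 : ((n + 1 : ℕ) : ℤ) * (x / (m + 1 : ℕ) + 1) ≤ (n + 1 : ℕ) * (y / (m + 1 : ℕ)) :=
      mul_le_mul_of_nonneg_left hlt (by omega)
    have h3 : (0 : ℤ) ≤ (φ (cyc m y) : ℕ) := by omega
    rw [mul_add, mul_one] at h2
    omega

lemma periodic_id (x : ℤ) : periodic (OrderHom.id : Fin (n + 1) →o Fin (n + 1)) x = x := by
  rw [periodic, OrderHom.id_coe, _root_.id, cyc_val, add_comm, Int.mul_ediv_add_emod]

/-- `periodic ψ x` is a value of `ψ`, hence in `[0, m]`, plus a multiple of `m + 1`; `periodic φ`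
turns that multiple into the same multiple of `n + 1`. -/
lemma periodic_comp (ψ : Fin (p + 1) →o Fin (m + 1)) (x : ℤ) :
    periodic (φ.comp ψ) x = periodic φ (periodic ψ x) := by
  conv_rhs => rw [periodic.eq_1 ψ, periodic_period, periodic_coe]
  rfl

lemma periodic_ext {φ ψ : Fin (m + 1) →o Fin (n + 1)} (h : ∀ i : Fin (m + 1),
    periodic φ (i : ℕ) = periodic ψ (i : ℕ)) : φ = ψ := by
  ext i
  have := h i
  rw [periodic_coe, periodic_coe] at this
  exact_mod_cast this

/-- On the integers, conjugation by the reflections is conjugation by `x ↦ n - x` and `x ↦ m - x`.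
Both sides shift by `n + 1` over a period, so the arguments `0, …, m` suffice. -/
lemma periodic_revConj (x : ℤ) : periodic (revConj true φ) x = n - periodic φ (m - x) := by
  have key : ∀ i : Fin (m + 1), periodic (revConj true φ) (i : ℕ) =
      n - periodic φ (m - (i : ℕ)) := by
    intro i
    have : (m - (i : ℕ) : ℤ) = (i.rev : ℕ) := by
      rw [Fin.val_rev]
      omega
    rw [this, periodic_coe, periodic_coe, revConj_true, Fin.val_rev]
    omega
  have hx : x = (cyc m x : ℕ) + (m + 1 : ℕ) * (x / (m + 1 : ℕ)) := by
    rw [cyc_val, add_comm, Int.mul_ediv_add_emod]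
  rw [hx, periodic_period, key,
    show ∀ a b q : ℤ, (m - (a + b * q)) = (m - a) + b * (-q) by intros; ring, periodic_period]
  ring

end PeriodicExtension

/-! ### The functor from the opposite reflexive category to based maps -/

section BasedMaps

variable {n m p : ℕ}

/-- The labelled fibres of the based map `[n] → [m]` dual to `φ : [m] → [n]`. -/
def dualFiber (φ : Fin (m + 1) →o Fin (n + 1)) (i : Fin (m + 1)) : List (Fin (n + 1) × Bool) :=
  seg n (periodic φ ((i : ℕ) - 1)) (periodic φ (i : ℕ))

/-- Shifting `x` by a period moves both endpoints by `n + 1`, which leaves the residues unchanged.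
-/
lemma dualFiber_cyc (φ : Fin (m + 1) →o Fin (n + 1)) (x : ℤ) :
    dualFiber φ (cyc m x) = seg n (periodic φ (x - 1)) (periodic φ x) := by
  have hx : x = (cyc m x : ℕ) + (m + 1 : ℕ) * (x / (m + 1 : ℕ)) := by
    rw [cyc_val, add_comm, Int.mul_ediv_add_emod]
  conv_rhs => rw [hx, add_sub_right_comm, periodic_period, periodic_period, seg_period]
  rfl

/-- The intervals `(Φ(x-1), Φ(x)]` for `s < x ≤ t` are adjacent and concatenate to `(Φ(s), Φ(t)]`.
Both the total list of a dual map and composition of dual maps are read off from this. -/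
lemma pull_dualFiber (φ : Fin (m + 1) →o Fin (n + 1)) {s t : ℤ} (h : s ≤ t) :
    pull (dualFiber φ) (seg m s t) = seg n (periodic φ s) (periodic φ t) := by
  induction t, h using Int.leInduction with
  | base => rw [seg_self, seg_self, pull_nil]
  | succ t h ih =>
    rw [← seg_append m h (show t ≤ t + 1 by omega), pull_append, ih, seg_one, pull_cons, pull_nil,
      List.append_nil, act_false, dualFiber_cyc, add_sub_cancel_right]
    exact seg_append n (periodic_mono φ h) (periodic_mono φ (by omega))

lemma flatMap_dualFiber (φ : Fin (m + 1) →o Fin (n + 1)) :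
    (List.finRange (m + 1)).flatMap (dualFiber φ) =
      seg n (periodic φ (-1)) (periodic φ (-1) + (n + 1 : ℕ)) := by
  rw [← pull_std, ← seg_eq_std, pull_dualFiber φ (by omega), ← periodic_add]
  congr 2
  push_cast
  ring

lemma flatMap_dualFiber_perm (φ : Fin (m + 1) →o Fin (n + 1)) :
    (((List.finRange (m + 1)).flatMap (dualFiber φ)).map Prod.fst).Perm
      (List.finRange (n + 1)) := by
  rw [flatMap_dualFiber]
  have := (isRotated_seg n (periodic φ (-1))).perm.map Prod.fst
  simpa [std, Function.comp_def] using this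

/-- A morphism is determined by fibres whose concatenation contains every element once. -/
noncomputable def homOfFiber (F : Fin (m + 1) → List (Fin (n + 1) × Bool))
    (h : (((List.finRange (m + 1)).flatMap F).map Prod.fst).Perm (List.finRange (n + 1))) :
    (⟨n⟩ : IFas) ⟶ ⟨m⟩ :=
  have hex : ∀ j, ∃ i, j ∈ (F i).map Prod.fst := fun j => by
    have := h.mem_iff.2 (List.mem_finRange j)
    rw [List.map_flatMap, List.mem_flatMap] at this
    obtain ⟨i, -, hi⟩ := this
    exact ⟨i, hi⟩
  have hn : (∀ i, ((F i).map Prod.fst).Nodup) ∧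
      ∀ i i', i ≠ i' → List.Disjoint ((F i).map Prod.fst) ((F i').map Prod.fst) := by
    have hp := h.nodup_iff.2 (List.nodup_finRange _)
    rw [List.map_flatMap, List.nodup_flatMap] at hp
    refine ⟨fun i => hp.1 i (List.mem_finRange i), fun i i' hne => ?_⟩
    have : Std.Symm (Function.onFun List.Disjoint fun i => (F i).map Prod.fst) :=
      ⟨fun _ _ h => List.Disjoint.symm h⟩
    exact hp.2.forall (List.mem_finRange i) (List.mem_finRange i') hne
  { toFun := fun j => (hex j).choose
    fiber := F
    nodup := hn.1
    mem_fiber := fun i j => by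
      constructor
      · intro hj
        by_contra hne
        exact hn.2 _ _ hne (hex j).choose_spec hj
      · rintro rfl
        exact (hex j).choose_spec : IFHom n m }

/-- The based map `[n] → [m]` dual to an order-preserving map `φ : [m] → [n]`. -/
noncomputable def dual (φ : Fin (m + 1) →o Fin (n + 1)) : (⟨n⟩ : IFas) ⟶ ⟨m⟩ :=
  homOfFiber (dualFiber φ) (flatMap_dualFiber_perm φ)

lemma dual_fiber (φ : Fin (m + 1) →o Fin (n + 1)) (i : Fin (m + 1)) :
    IFHom.fiber (dual φ) i = seg n (periodic φ ((i : ℕ) - 1)) (periodic φ (i : ℕ)) := rfl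

lemma dual_fiber_zero (φ : Fin (m + 1) →o Fin (n + 1)) :
    IFHom.fiber (dual φ) 0 =
      seg n ((φ (Fin.last m) : ℕ) - (n + 1 : ℕ)) (φ 0 : ℕ) := by
  rw [dual_fiber, ← periodic_neg_one, ← periodic_zero]
  simp

lemma dual_fiber_succ (φ : Fin (m + 1) →o Fin (n + 1)) (i : Fin m) :
    IFHom.fiber (dual φ) i.succ = seg n (φ i.castSucc : ℕ) (φ i.succ : ℕ) := by
  rw [dual_fiber, ← periodic_coe, ← periodic_coe]
  simp

lemma tot_dual (φ : Fin (m + 1) →o Fin (n + 1)) :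
    tot (dual φ) = seg n (periodic φ (-1)) (periodic φ (-1) + (n + 1 : ℕ)) :=
  flatMap_dualFiber φ

lemma dual_based (φ : Fin (m + 1) →o Fin (n + 1)) : IFHom.toFun (dual φ) 0 = 0 := by
  rw [← IFHom.mem_fiber, dual_fiber_zero]
  -- The integer `0` lies in the interval over `0`, since `φ(m) - (n + 1) < 0 ≤ φ(0)`.
  refine List.mem_map.2 ⟨(0, false), mem_seg.2 ⟨0, ?_, by omega, ?_⟩, rfl⟩
  · have := (φ (Fin.last m)).2
    omega
  · exact congrArg (·, false) (cyc_coe 0).symm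

lemma dual_id : dual (OrderHom.id : Fin (n + 1) →o Fin (n + 1)) = 𝟙 (⟨n⟩ : IFas) := by
  apply IFHom.ext_fiber
  intro i
  rw [dual_fiber, periodic_id, periodic_id, id_fiber]
  have := seg_one n ((i : ℕ) - 1)
  rw [sub_add_cancel, cyc_coe] at this
  exact this

lemma dual_comp (φ : Fin (m + 1) →o Fin (n + 1)) (ψ : Fin (p + 1) →o Fin (m + 1)) :
    dual (φ.comp ψ) = dual φ ≫ dual ψ := by
  apply IFHom.ext_fiber
  intro i
  rw [comp_fiber, dual_fiber, dual_fiber, periodic_comp, periodic_comp]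
  exact (pull_dualFiber φ (periodic_mono ψ (by omega))).symm

lemma cyc_neg_cyc (x : ℤ) : cyc n (-((cyc n x : ℕ) : ℤ)) = cyc n (-x) := by
  rw [cyc_eq_iff, cyc_val]
  exact (Int.mod_modEq x _).neg

/-- The permutation `i ↦ -i` of the residues modulo `n + 1`. -/
def negPerm (n : ℕ) : Equiv.Perm (Fin (n + 1)) :=
  Function.Involutive.toPerm (fun i => cyc n (-(i : ℕ))) fun i => by
    change cyc n (-((cyc n (-(i : ℕ)) : ℕ) : ℤ)) = i
    rw [cyc_neg_cyc, neg_neg, cyc_coe]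

/-- The based reflection `i ↦ -i` with all labels `t`, if `z = t`, and the identity otherwise. -/
def reflHyp (n : ℕ) (z : Bool) : Hyp n := ⟨fun _ => z, if z then negPerm n else Equiv.refl _⟩

lemma reflHyp_true_fiber (i : Fin (n + 1)) :
    IFHom.fiber (reflHyp n true).toHom i = [(cyc n (-(i : ℕ)), true)] := rfl

lemma reflHyp_false : (reflHyp n false).toHom = 𝟙 _ := rfl

lemma reflHyp_comp (z w : Bool) :
    (reflHyp n z).toHom ≫ (reflHyp n w).toHom = (reflHyp n (xor z w)).toHom := by
  cases z <;> cases w <;> simp only [reflHyp_false, Bool.xor_false, Bool.xor_true,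
    Category.id_comp, Category.comp_id, Bool.not_false, Bool.not_true]
  exact (reflHyp n true).toHom_inv

lemma reflHyp_based (z : Bool) : IFHom.toFun (reflHyp n z).toHom 0 = 0 := by
  cases z
  · rfl
  · exact cyc_coe 0

/-- Negation maps `(s, t]` to the integers of `(-t-1, -s-1]` in reverse order; the shift by one
comes from exchanging the open and closed ends. -/
lemma pull_reflHyp {s t : ℤ} (h : s ≤ t) :
    pull (IFHom.fiber (reflHyp n true).toHom) (seg n s t) =
      act true (seg n (-t - 1) (-s - 1)) := by
  induction t, h using Int.leInduction with
  | base => rw [seg_self, seg_self, pull_nil, act_nil]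
  | succ t h ih =>
    rw [← seg_append n h (show t ≤ t + 1 by omega), pull_append, ih, seg_one, pull_cons, pull_nil,
      List.append_nil, act_false, reflHyp_true_fiber, cyc_neg_cyc,
      ← seg_append n (show -(t + 1) - 1 ≤ -t - 1 by omega) (show -t - 1 ≤ -s - 1 by omega),
      act_true_append]
    have := seg_one n (-(t + 1) - 1)
    rw [show -(t + 1) - 1 + 1 = -t - 1 by ring] at this
    rw [this, act_singleton]
    congr 4
    ring

/-- This mirrors the rule by which `DeltaR` moves its reflection past an order-preserving map, and
is what `dualFunctor` needs to respect composition. -/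
lemma reflHyp_dual (z : Bool) (φ : Fin (m + 1) →o Fin (n + 1)) :
    (reflHyp n z).toHom ≫ dual φ = dual (revConj z φ) ≫ (reflHyp m z).toHom := by
  cases z
  · rw [reflHyp_false, reflHyp_false, revConj_false, Category.id_comp, Category.comp_id]
  · apply IFHom.ext_fiber
    intro i
    rw [comp_fiber, comp_fiber, dual_fiber, pull_reflHyp (periodic_mono φ (by omega)),
      reflHyp_true_fiber, pull_cons, pull_nil, List.append_nil]
    change _ = act true (dualFiber _ _)
    -- The endpoints of the interval at `-i` are reflections of `Φ(i)` and `Φ(i-1)`, each one period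
    -- further on; hence the order is reversed.
    rw [dualFiber_cyc, periodic_revConj, periodic_revConj,
      show (m - (-(i : ℕ) - 1) : ℤ) = (i : ℕ) + (m + 1 : ℕ) by push_cast; ring,
      show (m - (-(i : ℕ)) : ℤ) = ((i : ℕ) - 1) + (m + 1 : ℕ) by push_cast; ring,
      periodic_add, periodic_add]
    congr 2 <;> push_cast <;> ring

/-- The inclusion of the opposite of the reflexive category into based involutive
non-commutative sets. -/
noncomputable def dualFunctor : DeltaRᵒᵖ ⥤ IGammaAs where
  obj x := ⟨⟨x.unop.n⟩⟩
  map {x y} f :=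
    ⟨dual (DeltaRHom.map f.unop) ≫ (reflHyp y.unop.n (DeltaRHom.refl f.unop)).toHom,
      IsBased.comp_mem _ _ (dual_based _) (reflHyp_based _)⟩
  map_id x := by
    apply WideSubcategory.hom_ext
    change dual OrderHom.id ≫ (reflHyp x.unop.n false).toHom = 𝟙 _
    rw [reflHyp_false, dual_id, Category.id_comp]
  map_comp {x y z} f g := by
    apply WideSubcategory.hom_ext
    change dual ((DeltaRHom.map f.unop).comp (revConj (DeltaRHom.refl f.unop)
        (DeltaRHom.map g.unop))) ≫
        (reflHyp z.unop.n (xor (DeltaRHom.refl f.unop) (DeltaRHom.refl g.unop))).toHom =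
      (dual (DeltaRHom.map f.unop) ≫ (reflHyp y.unop.n (DeltaRHom.refl f.unop)).toHom) ≫
      (dual (DeltaRHom.map g.unop) ≫ (reflHyp z.unop.n (DeltaRHom.refl g.unop)).toHom)
    rw [← reflHyp_comp, dual_comp, Category.assoc, Category.assoc,
      ← Category.assoc _ (dual (DeltaRHom.map g.unop)), reflHyp_dual, Category.assoc]

end BasedMaps

/-! ### The Loday functor as a restriction of the functor R(A, M) -/

section LodayComparison

variable {k A M : Type u} [CommRing k] [Ring A] [Algebra k A] [InvolutiveAlgebra k A]
  [AddCommGroup M] [Module k M] [Module A M] [Module Aᵐᵒᵖ M] [SMulCommClass A Aᵐᵒᵖ M]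
  [IsScalarTower k A M] [IsScalarTower k Aᵐᵒᵖ M] [InvolutiveBimodule A M]
  {n m : ℕ}

/-- Every integer of `(s, t]` lies between `1` and `n`, so it is its own residue and the module
position `0` never occurs. -/
lemma fiberProd_seg (a : Fin n → A) {s t : ℕ} (h : s ≤ t) (ht : t ≤ n) :
    fiberProd k (seg n s t) a = segProd a s t := by
  induction t, h using Nat.le_induction with
  | base => rw [seg_self, segProd_self, fiberProd_nil]
  | succ t h ih =>
    have e : cyc n ((t : ℤ) + 1) = Fin.succ ⟨t, ht⟩ := by
      rw [← cyc_coe (Fin.succ ⟨t, ht⟩)]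
      simp
    rw [Nat.cast_succ, ← seg_append n (show (s : ℤ) ≤ t by omega) (show (t : ℤ) ≤ t + 1 by omega),
      fiberProd_append, ih (by omega), segProd_succ_right a h ht, seg_one, e, fiberProd_cons,
      fiberProd_nil, mul_one, conjA_false, Fin.cons_succ]

/-- Integers strictly between `-(n + 1)` and `0` are not divisible by `n + 1`; the left end of the
interval is excluded, so equality is harmless there. -/
lemma zero_notMem_seg {s t : ℤ} (h : -(n + 1 : ℕ) ≤ s) (h' : t < 0) :
    0 ∉ (seg n s t).map Prod.fst := by
  rw [List.mem_map]
  rintro ⟨p, hp, hp0⟩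
  obtain ⟨x, h1, h2, rfl⟩ := mem_seg.1 hp
  have h3 := cyc_val n x
  rw [show cyc n x = 0 from hp0, ← Int.add_emod_right, Int.emod_eq_of_lt (by omega) (by omega)]
    at h3
  simp only [Fin.val_zero] at h3
  omega

/-- The integer `0` splits the interval `(φ(m) - (n+1), φ(0)]`. The negative part, shifted by one
period, is `(φ(m), n]` and acts on the left; the positive part `(0, φ(0)]` acts on the right. This
is the cyclic wrap-around in the last Hochschild face. -/
lemma baseProd_dual (φ : Fin (m + 1) →o Fin (n + 1)) (a : Fin n → A) (x : M) :
    baseProd k M (IFHom.fiber (dual φ) 0) a x =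
      segProd a (φ (Fin.last m)) n • (MulOpposite.op (segProd a 0 (φ 0)) • x) := by
  have hlt : (φ (Fin.last m) : ℕ) < n + 1 := (φ (Fin.last m)).2
  have e : seg n ((φ (Fin.last m) : ℕ) - (n + 1 : ℕ)) (φ 0 : ℕ) =
      seg n ((φ (Fin.last m) : ℕ) - (n + 1 : ℕ)) (-1) ++ (0, false) :: seg n 0 (φ 0 : ℕ) := by
    have h0 : [((0 : Fin (n + 1)), false)] = seg n (-1) 0 := by
      have := seg_one n (-1)
      rw [show (-1 + 1 : ℤ) = ((0 : Fin (n + 1)) : ℕ) by simp, cyc_coe] at this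
      exact this.symm
    rw [List.append_cons, h0, seg_append n (by omega) (by omega), seg_append n (by omega) (by omega)]
  have e1 : seg n ((φ (Fin.last m) : ℕ) - (n + 1 : ℕ)) (-1) = seg n (φ (Fin.last m) : ℕ) n := by
    rw [← seg_add]
    congr 1 <;> push_cast <;> ring
  have e2 := fiberProd_seg (k := k) a (Nat.zero_le (φ 0 : ℕ)) (Fin.is_le _)
  have h0 : 0 ∉ (seg n ((φ (Fin.last m) : ℕ) - (n + 1 : ℕ)) (-1)).map Prod.fst :=
    zero_notMem_seg (by omega) (by omega)
  rw [dual_fiber_zero, e, baseProd_split h0, e1,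
    fiberProd_seg a (Fin.is_le _) le_rfl, conjM_false]
  rw [Nat.cast_zero] at e2
  rw [e2]

/-- The based map dual to an order-preserving map. -/
noncomputable def basedDual (φ : Fin (m + 1) →o Fin (n + 1)) : (⟨⟨n⟩⟩ : IGammaAs) ⟶ ⟨⟨m⟩⟩ :=
  ⟨dual φ, dual_based φ⟩

/-- The based reflection as a morphism of `IGammaAs`. -/
def basedRefl (n : ℕ) (z : Bool) : (⟨⟨n⟩⟩ : IGammaAs) ⟶ ⟨⟨n⟩⟩ :=
  ⟨(reflHyp n z).toHom, reflHyp_based z⟩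

lemma mapR_basedDual (φ : Fin (m + 1) →o Fin (n + 1)) :
    mapR (k := k) (A := A) (M := M) (basedDual φ) = lodayMap φ := by
  apply hom_ext_pureTensor
  intro x a
  rw [mapR_pureTensor, lodayMap_pureTensor]
  refine congrArg₂ (pureTensor k) (baseProd_dual φ a x) ?_
  funext i
  refine (congrArg (fun l => fiberProd k l a) (dual_fiber_succ φ i)).trans ?_
  exact fiberProd_seg a (φ.monotone i.castSucc_le_succ) (Fin.is_le _)

lemma mapR_basedRefl (z : Bool) :
    mapR (k := k) (A := A) (M := M) (basedRefl n z) = reflectionMap z := by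
  cases z
  · rw [reflectionMap_false]
    exact mapR_id _
  · apply hom_ext_pureTensor
    intro x a
    rw [mapR_pureTensor, reflectionMap_true]
    refine congrArg₂ (pureTensor k) ?_ ?_
    · have : IFHom.fiber (basedRefl n true).hom 0 = [(0, true)] :=
        congrArg (fun i => [(i, true)]) (cyc_coe 0)
      rw [this, baseProd_cons_zero, fiberProd_nil, conjM_true, MulOpposite.op_one, one_smul]
    · funext i
      have e : IFHom.fiber (basedRefl n true).hom i.succ = [(i.rev.succ, true)] := by
        -- `-(i + 1)` is congruent to `n - i`, and reversal in `Fin n` followed by `succ` gives `(n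
        -- - 1 - i) + 1`.
        have : cyc n (-(i.succ : ℕ)) = i.rev.succ := by
          rw [← cyc_coe i.rev.succ, ← cyc_add]
          congr 1
          simp only [Fin.val_succ, Fin.val_rev]
          omega
        exact congrArg (fun i => [(i, true)]) this
      rw [e, fiberProd_cons, fiberProd_nil, mul_one, conjA_true]
      rfl

lemma mapR_dualFunctor {x y : DeltaRᵒᵖ} (f : x ⟶ y) :
    mapR (k := k) (A := A) (M := M) (dualFunctor.map f) =
      reflectionMap (DeltaRHom.refl f.unop) ∘ₗ lodayMap (DeltaRHom.map f.unop) := by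
  rw [← mapR_basedDual, ← mapR_basedRefl, ← mapR_comp]
  rfl

variable (k A M) in
/-- The Loday functor is the restriction of `R(A, M)` to the reflexive category. -/
noncomputable def lodayIso : lodayFunctor k A M ≅ dualFunctor ⋙ functorR k A M :=
  NatIso.ofComponents (fun _ => Iso.refl _) (by
    intro x y f
    apply ModuleCat.hom_ext
    exact (mapR_dualFunctor f).symm)

end LodayComparison

/-! ### Based dihedral maps come uniquely from the reflexive category -/

section DihedralMaps

variable {n m : ℕ}

lemma isDihedral_dual (φ : Fin (m + 1) →o Fin (n + 1)) : IsDihedral (dual φ) :=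
  isDihedral_of_dih ⟨false, by rw [tot_dual]; exact isRotated_seg _ _⟩

lemma tot_reflHyp_true (n : ℕ) : (tot (reflHyp n true).toHom).IsRotated (act true (std n)) := by
  rw [tot_eq, ← seg_eq_std, pull_reflHyp (by omega), seg_eq_std]
  apply isRotated_act
  have := isRotated_seg n (-(n : ℤ) - 1)
  rw [show (-(n : ℤ) - 1 + (n + 1 : ℕ)) = - -1 - 1 by push_cast; ring] at this
  exact this

lemma isDihedral_reflHyp (z : Bool) : IsDihedral (reflHyp n z).toHom := by
  cases z
  · exact isDihedral_id _
  · exact isDihedral_of_dih ⟨true, tot_reflHyp_true n⟩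

lemma rotate_std (n j : ℕ) : (std n).rotate j = seg n ((j : ℤ) - 1) (j - 1 + (n + 1 : ℕ)) := by
  apply List.ext_getElem
  · simp only [List.length_rotate, length_seg, std, List.length_map, List.length_finRange]
    omega
  · intro i h1 h2
    rw [getElem_seg, List.getElem_rotate]
    simp only [std, List.getElem_map, List.getElem_finRange]
    congr 1
    have := cyc_val n ((j : ℤ) - 1 + 1 + i)
    ext
    simp only [List.length_map, List.length_finRange, Fin.val_cast]
    zify
    rw [this]
    congr 1
    ring

/-- A rotation of the standard list is a window of length `n + 1`, whose start may be moved by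
periods. The normalisation `-(n+1) ≤ s < 0` makes the integer `0` the representative of the base
point inside the window. -/
lemma exists_seg_of_isRotated {l : List (Fin (n + 1) × Bool)} (h : l.IsRotated (std n)) :
    ∃ s : ℤ, -(n + 1 : ℕ) ≤ s ∧ s < 0 ∧ l = seg n s (s + (n + 1 : ℕ)) := by
  obtain ⟨j, rfl⟩ := h.symm
  set r : ℤ := j - 1
  refine ⟨r % (n + 1 : ℕ) - (n + 1 : ℕ), ?_, ?_, ?_⟩
  · have := Int.emod_nonneg r (b := (n + 1 : ℕ)) (by omega)
    omega
  · have := Int.emod_lt_of_pos r (b := (n + 1 : ℕ)) (by omega)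
    omega
  · rw [rotate_std, ← seg_period n (-(r / (n + 1 : ℕ)) - 1)]
    have := Int.mul_ediv_add_emod r (n + 1 : ℕ)
    congr 1 <;> linarith

lemma append_eq_seg {l l' : List (Fin (n + 1) × Bool)} {s t : ℤ} (hst : s ≤ t)
    (h : l ++ l' = seg n s t) :
    ∃ w, s ≤ w ∧ w ≤ t ∧ l = seg n s w ∧ l' = seg n w t := by
  have hl := congrArg List.length h
  rw [List.length_append, length_seg] at hl
  -- The cut point is forced by the length of the first list.
  refine ⟨s + l.length, by omega, by omega, ?_⟩
  rw [← seg_append n (show s ≤ s + l.length by omega) (by omega)] at h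
  exact List.append_inj h (by rw [length_seg]; omega)

/-- When lists concatenate to an interval, each is a subinterval. The endpoints are recorded as a
function on `ℕ`, whose values past `p` play no role. -/
lemma exists_cuts {p : ℕ} (F : Fin p → List (Fin (n + 1) × Bool)) {s t : ℤ} (hst : s ≤ t)
    (h : (List.finRange p).flatMap F = seg n s t) :
    ∃ c : ℕ → ℤ, c 0 = s ∧ c p = t ∧ Monotone c ∧
      ∀ i : Fin p, F i = seg n (c i) (c (i + 1)) := by
  induction p generalizing s with
  | zero =>
    have := congrArg List.length h
    rw [length_seg] at this
    simp only [List.finRange_zero, List.flatMap_nil, List.length_nil] at this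
    exact ⟨fun _ => s, rfl, show s = t by omega, monotone_const, fun i => i.elim0⟩
  | succ p ih =>
    rw [List.finRange_succ, List.flatMap_cons, List.flatMap_map] at h
    obtain ⟨w, h1, h2, h3, h4⟩ := append_eq_seg hst h
    obtain ⟨c, hc0, hc1, hc2, hc3⟩ := ih (fun i => F i.succ) h2 h4
    refine ⟨fun j => j.casesOn s c, rfl, hc1, ?_, ?_⟩
    · refine monotone_nat_of_le_succ fun j => ?_
      cases j with
      | zero => exact h1.trans hc0.ge
      | succ j => exact hc2 (Nat.le_succ j)
    · intro i
      refine Fin.cases ?_ (fun i => ?_) i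
      · change F 0 = seg n s (c 0)
        rw [hc0, h3]
      · exact hc3 i

/-- The concatenated fibres form a window `(s, s + n + 1]` cut at points `c`. Basedness puts the
integer `0` in the first piece, which forces all later cuts into `[0, n]`; these cuts are the values
of `φ`. -/
lemma exists_eq_dual (a : (⟨n⟩ : IFas) ⟶ ⟨m⟩) (h0 : IFHom.toFun a 0 = 0)
    (h : (tot a).IsRotated (std n)) : ∃ φ : Fin (m + 1) →o Fin (n + 1), a = dual φ := by
  obtain ⟨s, hs1, hs2, hs⟩ := exists_seg_of_isRotated h
  obtain ⟨c, hc0, hc1, hc, hF⟩ := exists_cuts (IFHom.fiber a) (by omega) hs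
  replace hc1 : c (m + 1) = s + (n + 1 : ℕ) := hc1
  -- A first piece ending before `0` would miss the residue `0`, by the normalisation of `s`.
  have hpos : 0 ≤ c 1 := by
    have h1 := (IFHom.mem_fiber a 0 0).2 h0
    rw [hF] at h1
    by_contra hlt
    refine zero_notMem_seg ?_ (not_le.1 hlt) h1
    exact hs1.trans hc0.ge
  have hle : ∀ i : Fin (m + 1), 0 ≤ c (i + 1) ∧ c (i + 1) < (n + 1 : ℕ) := by
    intro i
    have h1 := hc (show 1 ≤ (i : ℕ) + 1 by omega)
    have h2 := hc (show (i : ℕ) + 1 ≤ m + 1 by omega)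
    omega
  let φ : Fin (m + 1) →o Fin (n + 1) :=
    -- The fibre over `i` ends at `c (i + 1)`, which explains the shift. The cuts are nonnegative,
    -- so `toNat` loses nothing.
    ⟨fun i => ⟨(c (i + 1)).toNat, by have := hle i; omega⟩, fun i j hij =>
      Fin.le_def.2 (Int.toNat_le_toNat (hc (Nat.succ_le_succ hij)))⟩
  have hφ : ∀ i : Fin (m + 1), ((φ i : ℕ) : ℤ) = c (i + 1) := fun i =>
    Int.toNat_of_nonneg (hle i).1
  refine ⟨φ, IFHom.ext_fiber fun i => ?_⟩
  rw [hF]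
  refine Fin.cases ?_ (fun i => ?_) i
  · rw [dual_fiber_zero, hφ, hφ, Fin.val_last, hc1, add_sub_cancel_right, ← hc0]
    rfl
  · rw [dual_fiber_succ, hφ, hφ]
    rfl

/-- Composing with the based reflection turns the reversed case into the rotated one, and the
reflection is its own inverse. -/
lemma exists_eq_dual_comp_reflHyp {a : (⟨n⟩ : IFas) ⟶ ⟨m⟩} (h0 : IFHom.toFun a 0 = 0)
    (h : IsDihedral a) : ∃ (φ : Fin (m + 1) →o Fin (n + 1)) (z : Bool),
      a = dual φ ≫ (reflHyp m z).toHom := by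
  obtain ⟨α, hα⟩ := dih_of_isDihedral h
  cases α
  · obtain ⟨φ, rfl⟩ := exists_eq_dual a h0 hα
    exact ⟨φ, false, by rw [reflHyp_false, Category.comp_id]⟩
  · obtain ⟨φ, hφ⟩ := exists_eq_dual (a ≫ (reflHyp m true).toHom)
      (IsBased.comp_mem _ _ h0 (reflHyp_based true)) (by
        rw [tot_comp]
        -- The total list of the composite is, up to rotation, the reversed total list of `a`; the
        -- two reversals cancel.
        refine (isRotated_pull _ (tot_reflHyp_true m)).trans ?_
        rw [pull_act, ← tot_eq]
        have := isRotated_act hα true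
        rwa [act_act] at this)
    refine ⟨φ, true, ?_⟩
    rw [← hφ, Category.assoc, reflHyp_comp, Bool.xor_self, reflHyp_false, Category.comp_id]

/-- A segment need not determine its endpoints, as it may be empty. The fibre over `0` is nonempty,
and its first entry determines `Φ(-1)` modulo `n + 1`; since `Φ(-1)` lies in `[-(n+1), -1]`, it is
determined exactly. The lengths of the fibres then give the remaining values. -/
lemma dual_injective : Function.Injective
    (dual : (Fin (m + 1) →o Fin (n + 1)) → ((⟨n⟩ : IFas) ⟶ ⟨m⟩)) := by
  intro φ ψ h
  have hf : ∀ i : ℕ, i < m + 1 → seg n (periodic φ (i - 1)) (periodic φ i) =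
      seg n (periodic ψ (i - 1)) (periodic ψ i) := fun i hi =>
    congrArg (fun a => IFHom.fiber a ⟨i, hi⟩) h
  have hm : ∀ (χ : Fin (m + 1) →o Fin (n + 1)) (x : ℤ), periodic χ (x - 1) ≤ periodic χ x :=
    fun χ x => periodic_mono χ (by omega)
  have base : periodic φ (-1) = periodic ψ (-1) := by
    have h0 := hf 0 (by omega)
    rw [Nat.cast_zero, zero_sub] at h0
    have hφ := periodic_neg_one φ
    have hψ := periodic_neg_one ψ
    have hφ0 := periodic_zero φ
    have h1 := (φ (Fin.last m)).2
    have h2 := (ψ (Fin.last m)).2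
    have hmem : (cyc n (periodic φ (-1) + 1), false) =
        (cyc n (periodic ψ (-1) + 1), false) := by
      have hlen : 0 < (seg n (periodic φ (-1)) (periodic φ 0)).length := by
        rw [length_seg]
        omega
      have e1 := getElem_seg hlen
      have e2 := getElem_seg (h0 ▸ hlen)
      simp only [h0, Nat.cast_zero, add_zero] at e1 e2
      exact e1.symm.trans e2
    have := cyc_eq_iff.1 (congrArg Prod.fst hmem)
    rw [hφ, hψ] at this ⊢
    -- Both values lie in a range of `n + 1` consecutive integers, so congruence forces equality.
    have hz := Int.eq_zero_of_abs_lt_dvd (Int.ModEq.dvd this) (by rw [abs_lt]; omega)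
    omega
  have key : ∀ i : ℕ, i ≤ m + 1 → periodic φ ((i : ℤ) - 1) = periodic ψ (i - 1) := by
    intro i
    induction i with
    | zero => intro _; simpa using base
    | succ i ih =>
      intro hi
      have h1 := congrArg List.length (hf i hi)
      rw [length_seg, length_seg] at h1
      have h2 := ih (by omega)
      have h3 := hm φ i
      have h4 := hm ψ i
      rw [Nat.cast_succ, add_sub_cancel_right]
      omega
  apply periodic_ext
  intro i
  have := key (i + 1) (by omega)
  rwa [Nat.cast_succ, add_sub_cancel_right] at this

lemma label_eq_of_mem (φ : Fin (m + 1) →o Fin (n + 1)) (z : Bool) (i : Fin (m + 1))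
    {p : Fin (n + 1) × Bool} (h : p ∈ IFHom.fiber (dual φ ≫ (reflHyp m z).toHom) i) :
    p.2 = z := by
  have key : ∀ j, ∀ q ∈ IFHom.fiber (dual φ) j, q.2 = false := by
    intro j q hq
    rw [dual_fiber] at hq
    obtain ⟨x, -, -, rfl⟩ := mem_seg.1 hq
    rfl
  cases z
  · rw [reflHyp_false, Category.comp_id] at h
    exact key _ _ h
  · rw [comp_fiber, reflHyp_true_fiber, pull_cons, pull_nil, List.append_nil, act_true,
      List.mem_reverse, List.mem_map] at h
    obtain ⟨q, hq, rfl⟩ := h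
    simp [key _ _ hq]

/-- The common label of all entries reveals the reflection component; the fibre over `0` contains
`0`, so there is a label to read. Cancelling the reflection leaves `dual_injective`. -/
lemma dual_comp_reflHyp_injective {φ ψ : Fin (m + 1) →o Fin (n + 1)} {z w : Bool}
    (h : dual φ ≫ (reflHyp m z).toHom = dual ψ ≫ (reflHyp m w).toHom) : φ = ψ ∧ z = w := by
  have hz : z = w := by
    have h0 := (IFHom.mem_fiber (dual φ ≫ (reflHyp m z).toHom) 0 0).2
      (IsBased.comp_mem _ _ (dual_based φ) (reflHyp_based z))
    obtain ⟨p, hp, -⟩ := List.mem_map.1 h0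
    rw [← label_eq_of_mem φ z 0 hp]
    rw [h] at hp
    exact label_eq_of_mem ψ w 0 hp
  subst hz
  refine ⟨dual_injective ?_, rfl⟩
  have := congrArg (· ≫ (reflHyp m z).toHom) h
  simpa only [Category.assoc, reflHyp_comp, Bool.xor_self, reflHyp_false, Category.comp_id]
    using this

end DihedralMaps

/-! ### The factorization through H⁺ and the identification of B' -/

section Factorization

instance : dualFunctor.Faithful where
  map_injective {x y f g} h := by
    obtain ⟨h1, h2⟩ := dual_comp_reflHyp_injective (congrArg (fun a => a.hom) h)
    exact Quiver.Hom.unop_inj (DeltaRHom.ext h1 h2)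

lemma isDihedral_dualFunctor_map {x y : DeltaRᵒᵖ} (f : x ⟶ y) :
    IsDihedral (dualFunctor.map f).hom :=
  (isDihedral_dual _).comp (isDihedral_reflHyp _)

lemma exists_dualFunctor_map_eq {x y : DeltaRᵒᵖ} {a : (⟨x.unop.n⟩ : IFas) ⟶ ⟨y.unop.n⟩}
    (h0 : IFHom.toFun a 0 = 0) (h : IsDihedral a) :
    ∃ f : x ⟶ y, (dualFunctor.map f).hom = a := by
  obtain ⟨φ, z, rfl⟩ := exists_eq_dual_comp_reflHyp h0 h
  exact ⟨Quiver.Hom.op (X := y.unop) (Y := x.unop) (⟨φ, z⟩ : DeltaRHom _ _), rfl⟩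

lemma Hyp.toHom_cancel {n : ℕ} {y : IFas} (h : Hyp n) {a a' : (⟨n⟩ : IFas) ⟶ y}
    (e : h.toHom ≫ a = h.toHom ≫ a') : a = a' := by
  have := congrArg (h.inv.toHom ≫ ·) e
  simpa only [← Category.assoc, h.inv_toHom, Category.id_comp] using this

/-- An element of `H⁺` as a morphism to an object of the reflexive category. -/
def HPlus.toDual {d : IGammaAs} (h : HPlus d.obj.n) :
    d ⟶ dualFunctor.obj (op (⟨d.obj.n⟩ : DeltaR)) :=
  ⟨h.toHom, h.2.2⟩

/-- The dihedral factor of a based morphism is again based, because the `H⁺` factor fixes `0`; it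
therefore comes from `DeltaR`. -/
lemma exists_lift {d : IGammaAs} {c : DeltaRᵒᵖ} (g : d ⟶ dualFunctor.obj c) :
    ∃ f : op (⟨d.obj.n⟩ : DeltaR) ⟶ c,
      (hPlusPart g.hom).toDual ≫ dualFunctor.map f = g := by
  obtain ⟨a, ha, e⟩ := hPlusPart_spec g.hom
  have h0 : IFHom.toFun a 0 = 0 := by
    have h1 := based_zero g
    rw [e] at h1
    change IFHom.toFun a ((hPlusPart g.hom).1.perm 0) = 0 at h1
    rwa [(hPlusPart g.hom).2.2] at h1
  obtain ⟨f, hf⟩ := exists_dualFunctor_map_eq (x := op ⟨d.obj.n⟩) (y := c) h0 ha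
  refine ⟨f, ?_⟩
  apply WideSubcategory.hom_ext
  refine Eq.trans ?_ e.symm
  rw [← hf]
  rfl

/-- Every based morphism is uniquely an element of `H⁺` followed by a morphism of the reflexive
category. -/
noncomputable def hPlusFactorization : InitialFactorization dualFunctor where
  index d := HPlus d.obj.n
  obj {d} _ := op ⟨d.obj.n⟩
  arrow h := h.toDual
  part g := hPlusPart g.hom
  lift g := (exists_lift g).choose
  fac g := (exists_lift g).choose_spec
  -- Images of `dualFunctor` are dihedral, so uniqueness of the `H⁺` component applies.
  part_arrow_comp h a := hPlusPart_eq h (isDihedral_dualFunctor_map a)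
  -- Elements of `H⁺` are invertible and `dualFunctor` is faithful.
  cancel {d c} h a a' e := by
    apply dualFunctor.map_injective
    apply WideSubcategory.hom_ext
    exact Hyp.toHom_cancel h.1 (congrArg (fun g => g.hom) e)

/-- Both functors are free on `H⁺`, and both send `h` to the `H⁺` component of `f` followed by `h`.
The index type and arrows of `hPlusFactorization` are chosen so that this is definitional. -/
lemma componentModule_hPlusFactorization (k : Type u) [CommRing k] :
    hPlusFactorization.componentModule k = functorBPrime k := rfl

end Factorization

end ReflexiveHomology

/-! ### The comparison of reflexive homology with Tor over based involutive non-commutative sets -/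

theorem corollary10p2 {k A M : Type u} [CommRing k] [Ring A] [Algebra k A]
    [ReflexiveHomology.InvolutiveAlgebra k A]
    [AddCommGroup M] [Module k M] [Module A M] [Module Aᵐᵒᵖ M] [SMulCommClass A Aᵐᵒᵖ M]
    [IsScalarTower k A M] [IsScalarTower k Aᵐᵒᵖ M] [ReflexiveHomology.InvolutiveBimodule A M]
    (n : ℕ) :
    Nonempty (ReflexiveHomology.reflexiveHomology k A M n ≅
      ReflexiveHomology.functorTor n (ReflexiveHomology.functorBPrime k)
        (ReflexiveHomology.functorR k A M)) := by
  obtain ⟨e⟩ := ReflexiveHomology.hPlusFactorization.nonempty_functorTor_iso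
    (ReflexiveHomology.functorR k A M) n
  rw [ReflexiveHomology.componentModule_hPlusFactorization] at e
  exact ⟨((ReflexiveHomology.tensorOver
    (ReflexiveHomology.InitialFactorization.constModule k
      ReflexiveHomology.DeltaRᵒᵖ)).leftDerived n).mapIso
      (ReflexiveHomology.lodayIso k A M) ≪≫ e⟩
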